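/- **Setting.** Fix an integer $k\ge 2$ and strictly increasing sequences of natural numbers $(m_j)_{j\ge1}$, $(n_j)_{j\ge1}$ with $m_1\ge 4$, $m_{j+1}\ge m_j^2$, $n_1\ge m_1^2$ and $n_{j+1}\ge(16n_j)^{\log_2 m_{j+1}}$, and an increasing sequence of natural numbers $(N_r)_{r\ge1}$ (see below). *The set $\Gamma^{\max}$.* Pairwise disjoint finite sets $\Delta_1,\Delta_2,\dots$ are defined recursively, with $\Gamma^{\max}_r=\bigcup_{q\le r}\Delta_q$, $\Gamma^{\max}_0=\emptyset$ and $\Gamma^{\max}=\bigcup_q\Delta_q$; elements of $\Delta_q$ have rank $q$. Put $\Delta_1=\{0,1,\dots,k-1\}$; these elements have no weight. For $0\le p<r$ let $B_{p,r}$ be the set of all $b^*=\sum_{\eta\in\Gamma^{\max}_r\setminus\Gamma^{\max}_p}a_\eta e^*_\eta$ with $\sum|a_\eta|\le1$ and every $a_\eta$ a rational number with denominator dividing $N_r!$; it is assumed that $B_{p,r}$ is a $2^{-r}$-net in the unit ball of $\ell_1(\Gamma^{\max}_r\setminus\Gamma^{\max}_p)$. The set $\Delta_{r+1}$ consists of *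 the Type 1 elements $(r+1,p,m_j^{-1},b^*)$ with $0\le p<r$, $1\le j\le r+1$, $b^*\in B_{p,r}$ (of weight $m_j^{-1}$ and age $1$), and * the Type 2 elements $(r+1,\xi,m_j^{-1},b^*)$ with $1\le p<r$, $\xi\in\Delta_p$ of weight $m_j^{-1}$, $1\le j\le p$, $\operatorname{age}\xi<n_j$, $b^*\in B_{p,r}$ (of weight $m_j^{-1}$ and age $1+\operatorname{age}\xi$). *Functionals.* Let $c^*_\gamma=0$ for $\gamma\in\Delta_1$, $c^*_\gamma=m_j^{-1}(I-P^*_{(0,p)})b^*$ for a Type 1 element, $c^*_\gamma=e^*_\xi+m_j^{-1}(I-P^*_{(0,\operatorname{rank}\xi)})b^*$ for a Type 2 element, and $d^*_\gamma=e^*_\gamma-c^*_\gamma$, where the linear projection $P^*_{(0,q)}$ fixes $d^*_\gamma$ if $\operatorname{rank}\gamma\le q$ and sends it to $0$ otherwise. These conditions determine $c^*_\gamma$, $d^*_\gamma$ and $P^*_{(0,q)}$ recursively. *The partial map $G$.* A map $G:\Gamma^{\max}\to\Gamma^{\max}\cup\{\text{undefined}\}$ and the linear map $R^*$ on finitely supported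 functionals with $R^*e^*_\gamma=e^*_{G(\gamma)}$ if $G(\gamma)$ is defined, and $R^*e^*_\gamma=0$ otherwise, are defined by recursion on rank. On $\Delta_1$, $G(i)=i-1$ for $1\le i\le k-1$ and $G(0)$ is undefined. For $\gamma=(r+1,p,\beta,b^*)$ of Type 1, $G(\gamma)=(r+1,p,\beta,R^*b^*)$ if $(I-P^*_{(0,p)})R^*b^*\ne0$, and $G(\gamma)$ is undefined otherwise. For $\gamma=(r+1,\xi,\beta,b^*)$ of Type 2, $G(\gamma)=(r+1,G(\xi),\beta,R^*b^*)$ if $G(\xi)$ is defined; if $G(\xi)$ is undefined, then $G(\gamma)=(r+1,\operatorname{rank}\xi,\beta,R^*b^*)$ if $(I-P^*_{(0,\operatorname{rank}\xi)})R^*b^*\neq0$, and $G(\gamma)$ is undefined otherwise. *The set $\Gamma$.* Fix an injective $\sigma:\Gamma^{\max}\to\mathbb N$ with $\sigma(\gamma)>\operatorname{rank}\gamma$ for all $\gamma$, and $\sigma(\gamma)>\sigma(\xi)$ whenever $\operatorname{rank}\gamma>\operatorname{rank}\xi$. Put $\Sigma(\gamma)=\{\sigma(\delta):\delta\in\Gamma^{\max},\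 G^i(\delta)=\gamma\text{ for some }0\le i\le k-1\}$. The subset $\Gamma\subseteq\Gamma^{\max}$ is defined by recursion on rank. It contains $\Delta_1$. An element $(r+1,p,m_j^{-1},b^*)$ or $(r+1,\xi,m_j^{-1},b^*)$ of $\Gamma^{\max}$ belongs to $\Gamma$ if and only if $b^*$ is supported by $\Gamma$, $\xi\in\Gamma$ (for Type 2), and, in case $j$ is odd, either $b^*=0$, or $b^*=e^*_\eta$ for some $\eta$ of weight $m_{4i}^{-1}<n_j^{-2}$, where in Type 2 also $i\in\Sigma(\xi)$. *The space and the operator.* For $\delta\in\Gamma$ let $d_\delta\in\ell_\infty(\Gamma)$ be the vector with $\langle d_\delta,d^*_\gamma\rangle=1$ if $\gamma=\delta$ and $0$ for all other $\gamma\in\Gamma$. Let $\mathfrak X_k$ be the closed linear span of $\{d_\delta:\delta\in\Gamma\}$ in the real space $\ell_\infty(\Gamma)$. The operator $S$ is the bounded linear operator $S:\mathfrak X_k\to\mathfrak X_k$ with $$(Sx)(\gamma)=\begin{cases}x(G(\gamma))&\text{if }G(\gamma)\text{ is defined (in which case }G(\gamma)\in\Gamma),\\0&\text{otherwise}\end{cases}\qquad(x\in\mathfrak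 X_k,\ \gamma\in\Gamma).$$ **Corollary 3.8.** The operator $S$ is well defined: there is exactly one bounded linear operator $S$ on $\mathfrak X_k$ as above. Moreover: 1. if $\lambda_0,\dots,\lambda_{k-1}\in\mathbb R$ are such that $\sum_{i=0}^{k-1}\lambda_iS^i$ is compact, then $\lambda_i=0$ for every $i$; 2. for no $j\in\{0,\dots,k-1\}$ is $S^j$ of the form $\sum_{0\le l\le k-1,\ l\ne j}\mu_lS^l+K$ with $\mu_l\in\mathbb R$ and $K$ a compact operator on $\mathfrak X_k$; 3. the classes of $I,S,\dots,S^{k-1}$ are linearly independent in the Calkin algebra $\mathcal L(\mathfrak X_k)/\mathcal K(\mathfrak X_k)$. -/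

import Mathlib

open scoped ENNReal

noncomputable section

namespace BDSpace

/-! ### The index set

An element of rank `r + 1` codes a Bourgain-Delbaen functional over the set of elements of rank at
most `r`.  The weight `(m j)⁻¹` is recorded by its index `j ≥ 1`, and the functional `b` by its
rational coefficients.  `Pre k n` is the set of all formal elements of rank at most `n + 1`, before
any restriction is imposed; the restrictions are the predicates `InMax` and `InGamma` below. -/

/-- The codes of elements of the next rank over a set `α` of earlier elements: a Type 1 code is
`(p, (m j)⁻¹, b)`, a Type 2 code is `(ξ, (m j)⁻¹, b)`. -/
inductive Code (α : Type) : Type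
  | one (p j : ℕ) (b : α →₀ ℚ) : Code α
  | two (ξ : α) (j : ℕ) (b : α →₀ ℚ) : Code α

/-- Earlier elements together with the elements of the next rank. -/
inductive Step (α : Type) : Type
  | old (x : α) : Step α
  | new (c : Code α) : Step α

/-- Formal elements of rank at most `n + 1`. The elements of rank `1` are `0, …, k - 1`. -/
@[reducible] def Pre (k : ℕ) : ℕ → Type
  | 0 => Fin k
  | n + 1 => Step (Pre k n)

/-- Formal elements of rank exactly `n + 1`. -/
@[reducible] def Fresh (k : ℕ) : ℕ → Type
  | 0 => Fin k
  | n + 1 => Code (Pre k n)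

/-- All formal elements, of any rank. -/
def Node (k : ℕ) : Type := Σ n, Fresh k n

/-- An element of rank `n + 1`, regarded as one of rank at most `n + 1`. -/
def Fresh.toPre {k : ℕ} : ∀ {n : ℕ}, Fresh k n → Pre k n
  | 0, i => i
  | _ + 1, c => Step.new c

/-- The inclusion of the elements of rank at most `n + 1` in the set of all elements. -/
def Pre.toNode {k : ℕ} : ∀ {n : ℕ}, Pre k n → Node k
  | 0, i => ⟨0, i⟩
  | _ + 1, Step.old x => Pre.toNode x
  | n + 1, Step.new c => ⟨n + 1, c⟩

def Pre.rank {k : ℕ} : ∀ {n : ℕ}, Pre k n → ℕ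
  | 0, _ => 1
  | _ + 1, Step.old x => Pre.rank x
  | n + 1, Step.new _ => n + 2

/-- The index `j` of the weight `(m j)⁻¹`; the elements of rank `1` have no weight. -/
def Pre.weightIdx {k : ℕ} : ∀ {n : ℕ}, Pre k n → Option ℕ
  | 0, _ => none
  | _ + 1, Step.old x => Pre.weightIdx x
  | _ + 1, Step.new (Code.one _ j _) => some j
  | _ + 1, Step.new (Code.two _ j _) => some j

/-- The age of an element (the value at elements of rank `1`, which have no age, is irrelevant). -/
def Pre.age {k : ℕ} : ∀ {n : ℕ}, Pre k n → ℕ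
  | 0, _ => 0
  | _ + 1, Step.old x => Pre.age x
  | _ + 1, Step.new (Code.one _ _ _) => 1
  | _ + 1, Step.new (Code.two ξ _ _) => 1 + Pre.age ξ

def Node.rank {k : ℕ} (γ : Node k) : ℕ := γ.1 + 1

/-! ### The functionals `c*` and the projections `P*` -/

/-- A rational functional as a real one. -/
def toReal {α : Type} (b : α →₀ ℚ) : α →₀ ℝ := b.mapRange (fun a : ℚ => (a : ℝ)) Rat.cast_zero

/-- The `ℓ₁` norm of a finitely supported functional. -/
def l1norm {α : Type} (u : α →₀ ℝ) : ℝ := u.sum fun _ a => |a|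

/-- The functional `c*` of a code, given the ranks of the earlier elements and the projections
`P q = P*_{(0,q)}` on the functionals supported by the earlier elements. -/
def Code.cStar {α : Type} (m : ℕ → ℕ) (rank : α → ℕ) (P : ℕ → (α →₀ ℝ) →ₗ[ℝ] (α →₀ ℝ)) :
    Code α → (α →₀ ℝ)
  | Code.one p j b => (m j : ℝ)⁻¹ • (toReal b - P p (toReal b))
  | Code.two ξ j b =>
      Finsupp.single ξ 1 + (m j : ℝ)⁻¹ • (toReal b - P (rank ξ) (toReal b))

/-- The projection `P*_{(0,q)}` on the finitely supported functionals on the elements of rank at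
most `n + 1`. It fixes `d*_γ = e*_γ - c*_γ` if `rank γ ≤ q` and kills it otherwise; in terms of the
unit vectors this says that `e*_γ` is fixed if `rank γ ≤ q`, and is sent to `P*_{(0,q)} c*_γ`
otherwise. -/
def proj (k : ℕ) (m : ℕ → ℕ) : ∀ n : ℕ, ℕ → (Pre k n →₀ ℝ) →ₗ[ℝ] (Pre k n →₀ ℝ)
  | 0, q => if 1 ≤ q then LinearMap.id else 0
  | n + 1, q =>
      Finsupp.linearCombination ℝ (fun γ : Step (Pre k n) =>
        match γ with
        | Step.old x => (proj k m n q (Finsupp.single x 1)).mapDomain Step.old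
        | Step.new c =>
            if n + 2 ≤ q then Finsupp.single (Step.new c) 1
            else (proj k m n q (c.cStar m Pre.rank (proj k m n))).mapDomain Step.old)

open Classical in
/-- `dVal k m δ γ` is the value at `γ` of the vector `d_δ` biorthogonal to the functionals
`d*_γ = e*_γ - c*_γ`; that is, `d_δ(γ) = ⟨d_δ, d*_γ⟩ + ⟨d_δ, c*_γ⟩`, where `⟨d_δ, d*_γ⟩` is `1` if
`γ = δ` and `0` otherwise. -/
def dVal (k : ℕ) (m : ℕ → ℕ) (δ : Node k) : ∀ n : ℕ, Pre k n → ℝ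
  | 0, i => if Pre.toNode (n := 0) i = δ then 1 else 0
  | n + 1, Step.old x => dVal k m δ n x
  | n + 1, Step.new c =>
      (if (⟨n + 1, c⟩ : Node k) = δ then 1 else 0) +
        (c.cStar m Pre.rank (proj k m n)).sum (fun η a => a * dVal k m δ n η)

/-! ### The partial map `G` -/

/-- The operator `R*` on finitely supported functionals associated with a partial map `g`:
`R* e*_η = e*_{g η}`, or `0` if `g η` is undefined. -/
def rStar {α : Type} (g : α → Option α) (b : α →₀ ℚ) : α →₀ ℚ :=
  b.sum fun η a =>
    match g η with
    | some η' => Finsupp.single η' a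
    | none => 0

open Classical in
/-- The partial map `G`, with `none` for `undefined`. -/
def Pre.G {k : ℕ} (m : ℕ → ℕ) : ∀ {n : ℕ}, Pre k n → Option (Pre k n)
  | 0, i => if i.val = 0 then none else some ⟨i.val - 1, lt_of_le_of_lt (Nat.sub_le _ _) i.isLt⟩
  | _ + 1, Step.old x => (Pre.G m x).map Step.old
  | n + 1, Step.new (Code.one p j b) =>
      if toReal (rStar (Pre.G m) b) - proj k m n p (toReal (rStar (Pre.G m) b)) = 0 then none
      else some (Step.new (Code.one p j (rStar (Pre.G m) b)))
  | n + 1, Step.new (Code.two ξ j b) =>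
      match Pre.G m ξ with
      | some ξ' => some (Step.new (Code.two ξ' j (rStar (Pre.G m) b)))
      | none =>
          if toReal (rStar (Pre.G m) b)
              - proj k m n (Pre.rank ξ) (toReal (rStar (Pre.G m) b)) = 0 then none
          else some (Step.new (Code.one (Pre.rank ξ) j (rStar (Pre.G m) b)))

def Node.G {k : ℕ} (m : ℕ → ℕ) (γ : Node k) : Option (Node k) :=
  (Pre.G m γ.2.toPre).map Pre.toNode

/-- The iterates of the partial map `G`. -/
def Node.iterG {k : ℕ} (m : ℕ → ℕ) : ℕ → Node k → Option (Node k)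
  | 0, γ => some γ
  | j + 1, γ => (Node.iterG m j γ).bind (Node.G m)

/-! ### The set `Γ^max` -/

/-- `b ∈ B_{p,r}`, where `M` says which of the elements of rank at most `r` are in `Γ^max`:
`b` is supported by elements of `Γ^max` of rank greater than `p`, its `ℓ₁` norm is at most `1`, and
its coefficients are rational numbers with denominator dividing `(N r)!`. -/
def InB {α : Type} (N : ℕ → ℕ) (rank : α → ℕ) (M : α → Prop) (p r : ℕ) (b : α →₀ ℚ) : Prop :=
  (∀ η ∈ b.support, M η ∧ p < rank η) ∧ l1norm (toReal b) ≤ 1 ∧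
    ∀ η, (b η).den ∣ (N r).factorial

/-- Membership in `Γ^max`. An element `Step.new c` here has rank `n + 2`, so that its functional
is in `B_{p, n+1}`. -/
def Pre.InMax {k : ℕ} (ns N : ℕ → ℕ) : ∀ {n : ℕ}, Pre k n → Prop
  | 0, _ => True
  | _ + 1, Step.old x => Pre.InMax ns N x
  | n + 1, Step.new (Code.one p j b) =>
      p < n + 1 ∧ 1 ≤ j ∧ j ≤ n + 2 ∧ InB N Pre.rank (Pre.InMax ns N) p (n + 1) b
  | n + 1, Step.new (Code.two ξ j b) =>
      Pre.InMax ns N ξ ∧ Pre.rank ξ < n + 1 ∧ 1 ≤ j ∧ j ≤ Pre.rank ξ ∧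
        Pre.weightIdx ξ = some j ∧ Pre.age ξ < ns j ∧
        InB N Pre.rank (Pre.InMax ns N) (Pre.rank ξ) (n + 1) b

/-- The set `Γ^max`. -/
def GammaMax (k : ℕ) (ns N : ℕ → ℕ) : Type := {γ : Node k // Pre.InMax ns N γ.2.toPre}

/-! ### The set `Γ` -/

/-- The set `Σ(γ)`: the values of `σ` at the `δ ∈ Γ^max` with `G^i δ = γ` for some
`0 ≤ i ≤ k - 1`. -/
def sigmaSet {k : ℕ} (m ns N : ℕ → ℕ) (σ : GammaMax k ns N → ℕ) (γ : Node k) : Set ℕ :=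
  {s | ∃ δ : GammaMax k ns N, ∃ i < k, Node.iterG m i δ.1 = some γ ∧ s = σ δ}

/-- Membership in `Γ` of an element of `Γ^max`. The functionals have to be supported by `Γ`; if the
index `j` of the weight is odd, then the functional is `0` or some `e*_η`, where the weight of `η`
is `(m (4 * i))⁻¹ < (ns j)⁻²`, and in Type 2 also `i ∈ Σ(ξ)`. -/
def Pre.InGammaAux {k : ℕ} (m ns N : ℕ → ℕ) (σ : GammaMax k ns N → ℕ) :
    ∀ {n : ℕ}, Pre k n → Prop
  | 0, _ => True
  | _ + 1, Step.old x => Pre.InGammaAux m ns N σ x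
  | _ + 1, Step.new (Code.one _ j b) =>
      (∀ η ∈ b.support, Pre.InGammaAux m ns N σ η) ∧
        (Odd j → b = 0 ∨ ∃ η, b = Finsupp.single η 1 ∧ ∃ i, Pre.weightIdx η = some (4 * i) ∧
          (m (4 * i) : ℝ)⁻¹ < ((ns j : ℝ) ^ 2)⁻¹)
  | _ + 1, Step.new (Code.two ξ j b) =>
      Pre.InGammaAux m ns N σ ξ ∧ (∀ η ∈ b.support, Pre.InGammaAux m ns N σ η) ∧
        (Odd j → b = 0 ∨ ∃ η, b = Finsupp.single η 1 ∧ ∃ i, Pre.weightIdx η = some (4 * i) ∧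
          (m (4 * i) : ℝ)⁻¹ < ((ns j : ℝ) ^ 2)⁻¹ ∧ i ∈ sigmaSet m ns N σ (Pre.toNode ξ))

/-- The set `Γ`. -/
def Gamma (k : ℕ) (m ns N : ℕ → ℕ) (σ : GammaMax k ns N → ℕ) : Type :=
  {γ : Node k // Pre.InMax ns N γ.2.toPre ∧ Pre.InGammaAux m ns N σ γ.2.toPre}

/-! ### The space and the operator -/

/-- The space `𝔛_k`: the closed linear span in `ℓ_∞(Γ)` of the vectors `d_δ`, `δ ∈ Γ`. -/
def space (k : ℕ) (m ns N : ℕ → ℕ) (σ : GammaMax k ns N → ℕ) :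
    Submodule ℝ (lp (fun _ : Gamma k m ns N σ => ℝ) ∞) :=
  (Submodule.span ℝ {x : lp (fun _ : Gamma k m ns N σ => ℝ) ∞ |
    ∃ δ : Gamma k m ns N σ, ∀ γ : Gamma k m ns N σ,
      x γ = dVal k m δ.1 γ.1.1 γ.1.2.toPre}).topologicalClosure

/-- The Banach space `𝔛_k`. -/
def X (k : ℕ) (m ns N : ℕ → ℕ) (σ : GammaMax k ns N → ℕ) : Type := space k m ns N σ

instance (k : ℕ) (m ns N : ℕ → ℕ) (σ : GammaMax k ns N → ℕ) : NormedAddCommGroup (X k m ns N σ) :=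
  inferInstanceAs (NormedAddCommGroup (space k m ns N σ))

instance (k : ℕ) (m ns N : ℕ → ℕ) (σ : GammaMax k ns N → ℕ) : NormedSpace ℝ (X k m ns N σ) :=
  inferInstanceAs (NormedSpace ℝ (space k m ns N σ))

/-- The coordinate `x(γ)` of `x ∈ 𝔛_k ⊆ ℓ_∞(Γ)` at `γ ∈ Γ`. -/
def X.coord {k : ℕ} {m ns N : ℕ → ℕ} {σ : GammaMax k ns N → ℕ} (x : X k m ns N σ)
    (γ : Gamma k m ns N σ) : ℝ :=
  (show space k m ns N σ from x).1 γ

/-- The formula that defines the operator `S`: for every `γ ∈ Γ`, either `G γ` is undefined and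
`(S x)(γ) = 0`, or `G γ` is defined and in `Γ`, and `(S x)(γ) = x (G γ)`. In other words
`(S x)(γ) = ⟨x, S* e*_γ⟩`, where `S* e*_γ` is `e*_{G γ}` if `G γ` is defined, and `0` otherwise. -/
def IsShift {k : ℕ} {m ns N : ℕ → ℕ} {σ : GammaMax k ns N → ℕ}
    (S : X k m ns N σ →L[ℝ] X k m ns N σ) : Prop :=
  ∀ (x : X k m ns N σ) (γ : Gamma k m ns N σ),
    (Node.G m γ.1 = none ∧ (S x).coord γ = 0) ∨
      ∃ δ : Gamma k m ns N σ, Node.G m γ.1 = some δ.1 ∧ (S x).coord γ = x.coord δ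

/-- The Calkin algebra `ℒ(E) / 𝒦(E)` of a Banach space `E`, as a real vector space. -/
abbrev Calkin (E : Type) [NormedAddCommGroup E] [NormedSpace ℝ E] : Type :=
  (E →L[ℝ] E) ⧸ compactOperator (RingHom.id ℝ) E E

/-- The class of an operator in the Calkin algebra. -/
def toCalkin {E : Type} [NormedAddCommGroup E] [NormedSpace ℝ E] (T : E →L[ℝ] E) : Calkin E :=
  Submodule.Quotient.mk T

/-! ### Assumptions on the parameters -/

/-- The growth assumptions on the sequences `(m j)`, `(ns j)`, `j ≥ 1`; values at `0` are not
used. -/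
structure Growth (m ns : ℕ → ℕ) : Prop where
  m_strictMono : StrictMonoOn m (Set.Ici 1)
  ns_strictMono : StrictMonoOn ns (Set.Ici 1)
  m_one : 4 ≤ m 1
  m_succ : ∀ j, 1 ≤ j → m j ^ 2 ≤ m (j + 1)
  ns_one : m 1 ^ 2 ≤ ns 1
  ns_succ : ∀ j, 1 ≤ j → (16 * (ns j : ℝ)) ^ Real.logb 2 (m (j + 1)) ≤ (ns (j + 1) : ℝ)

/-- The assumptions on the sequence `(N r)`, `r ≥ 1`: it increases, and `B_{p,r}` is a
`2^{-r}`-net in the unit ball of `ℓ₁(Γ^max_r \ Γ^max_p)`. -/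
structure NetSeq (k : ℕ) (ns N : ℕ → ℕ) : Prop where
  mono : MonotoneOn N (Set.Ici 1)
  net : ∀ (n p : ℕ), p < n + 1 → ∀ u : Pre k n →₀ ℝ,
    (∀ η ∈ u.support, Pre.InMax ns N η ∧ p < Pre.rank η) → l1norm u ≤ 1 →
      ∃ b : Pre k n →₀ ℚ, InB N Pre.rank (Pre.InMax ns N) p (n + 1) b ∧
        l1norm (u - toReal b) ≤ (2 ^ (n + 1) : ℝ)⁻¹

/-- The assumptions on the coding function `σ : Γ^max → ℕ`. -/
structure Coding {k : ℕ} {ns N : ℕ → ℕ} (σ : GammaMax k ns N → ℕ) : Prop where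
  inj : Function.Injective σ
  rank_lt : ∀ γ, Node.rank γ.1 < σ γ
  mono : ∀ ξ γ : GammaMax k ns N, Node.rank ξ.1 < Node.rank γ.1 → σ ξ < σ γ

end BDSpace

end

/-!
Everything follows from the duality between the vectors `d_δ` and the functionals
`d*_γ = e*_γ - c*_γ`.

*Boundedness of `d_δ`.* Since `⟨d_δ, P*_{(0,q)} u⟩` is `⟨d_δ, u⟩` or `0` according to whether
`rank δ ≤ q` (`pairing_proj`), at most one term of `d_δ(γ) = [γ = δ] + ⟨d_δ, c*_γ⟩` is nonzero,
and `|d_δ| ≤ 1` on `Γ^max` (`abs_dVal_le_one`). So the spanning vectors of `𝔛_k` are really there.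

*Existence of `S`.* The map `G` preserves rank and weight, does not increase age, and leaves
`Γ^max` invariant (`inMax_G`). Moreover `G^k` is nowhere defined (`iter_G_eq_none`), whence
`Σ(ξ) ⊆ Σ(G ξ)` and `Γ` is invariant too (`inGammaAux_G`). The operator `R*` commutes with the
projections `P*_{(0,q)}` and maps `c*_γ` to `c*_{G γ}`, or to `0` if `G γ` is undefined
(`proj_shiftPre`, `shiftPre_cFun`). By duality the shift on `ℓ_∞(Γ)` maps `d_δ` to the sum of the
`d_γ` with `G γ = δ` (`dVal_G_eq_sum`), a finite sum because there are finitely many elements of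
each rank. Hence the shift, a contraction on `ℓ_∞(Γ)`, maps `𝔛_k` into itself. It is unique since
its coordinates are prescribed.

*Independence modulo the compact operators.* In every rank `n + 2` the set `Γ` contains a chain
`γ_{n,k-1} ↦ ⋯ ↦ γ_{n,1} ↦ γ_{n,0}` under `G`, where `γ_{n,i} = (n + 2, 0, (m 2)⁻¹, e*_i)`. The
vector `d_{γ_{n,0}}` vanishes at all elements of lower rank and at the other elements of its own
rank. So, for `T = ∑ c_a S^a`, the vector `T d_{γ_{n,0}}` has the coordinate `c_i` at `γ_{n,i}` and
`0` at `γ_{n',i}` for `n' < n`. The images under `T` of the unit-bounded sequence `(d_{γ_{n,0}})_n`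
are therefore `|c_i|`-separated, and if `T` is compact then `c_i = 0`. The other two assertions are
reformulations of this one.
-/

noncomputable section

namespace BDSpace

variable {k : ℕ}

/-! ### Ranks and the two descriptions of an element -/

theorem Pre.rank_le : ∀ {n : ℕ} (x : Pre k n), Pre.rank x ≤ n + 1
  | 0, _ => le_rfl
  | _ + 1, Step.old x => (Pre.rank_le x).trans (Nat.le_succ _)
  | _ + 1, Step.new _ => le_rfl

theorem Pre.one_le_rank : ∀ {n : ℕ} (x : Pre k n), 1 ≤ Pre.rank x
  | 0, _ => le_rfl
  | _ + 1, Step.old x => Pre.one_le_rank x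
  | n + 1, Step.new _ => Nat.le_add_left 1 (n + 1)

theorem Pre.rank_toNode : ∀ {n : ℕ} (x : Pre k n), (Pre.toNode x).rank = Pre.rank x
  | 0, _ => rfl
  | _ + 1, Step.old x => Pre.rank_toNode x
  | _ + 1, Step.new _ => rfl

theorem Fresh.toNode_toPre : ∀ {n : ℕ} (c : Fresh k n), Pre.toNode c.toPre = ⟨n, c⟩
  | 0, _ => rfl
  | _ + 1, _ => rfl

theorem dVal_toNode (m : ℕ → ℕ) (δ : Node k) : ∀ {n : ℕ} (x : Pre k n),
    dVal k m δ (Pre.toNode x).1 (Pre.toNode x).2.toPre = dVal k m δ n x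
  | 0, _ => rfl
  | _ + 1, Step.old x => dVal_toNode m δ x
  | _ + 1, Step.new _ => rfl

theorem inMax_toNode (ns N : ℕ → ℕ) : ∀ {n : ℕ} (x : Pre k n),
    Pre.InMax ns N (Pre.toNode x).2.toPre ↔ Pre.InMax ns N x
  | 0, _ => Iff.rfl
  | _ + 1, Step.old x => inMax_toNode ns N x
  | _ + 1, Step.new _ => Iff.rfl

theorem inGammaAux_toNode {m ns N : ℕ → ℕ} (σ : GammaMax k ns N → ℕ) : ∀ {n : ℕ} (x : Pre k n),
    Pre.InGammaAux m ns N σ (Pre.toNode x).2.toPre ↔ Pre.InGammaAux m ns N σ x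
  | 0, _ => Iff.rfl
  | _ + 1, Step.old x => inGammaAux_toNode σ x
  | _ + 1, Step.new _ => Iff.rfl

theorem Node.G_toNode (m : ℕ → ℕ) : ∀ {n : ℕ} (x : Pre k n),
    Node.G m (Pre.toNode x) = (Pre.G m x).map Pre.toNode
  | 0, _ => rfl
  | n + 1, Step.old x => by
      have h : Pre.G m (n := n + 1) (Step.old x) = (Pre.G m x).map Step.old := by simp [Pre.G]
      rw [h, Option.map_map]
      exact Node.G_toNode m x
  | _ + 1, Step.new _ => rfl

/-! ### Functionals -/

theorem toReal_add {α : Type} (b b' : α →₀ ℚ) : toReal (b + b') = toReal b + toReal b' :=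
  Finsupp.mapRange_add (by intros; push_cast; rfl) b b'

@[simp] theorem toReal_zero {α : Type} : toReal (0 : α →₀ ℚ) = 0 := Finsupp.mapRange_zero

@[simp] theorem toReal_single {α : Type} (x : α) (a : ℚ) :
    toReal (Finsupp.single x a) = Finsupp.single x (a : ℝ) := Finsupp.mapRange_single

theorem toReal_support {α : Type} (b : α →₀ ℚ) : (toReal b).support ⊆ b.support :=
  Finsupp.support_mapRange

/-- The functional `c*` attached to the new element with code `c`. -/
def cFun (m : ℕ → ℕ) {n : ℕ} (c : Code (Pre k n)) : Pre k n →₀ ℝ :=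
  c.cStar m Pre.rank (proj k m n)

/-- The value `⟨d_δ, u⟩` of the vector `d_δ` at a finitely supported functional `u`. -/
def pairing (m : ℕ → ℕ) (δ : Node k) (n : ℕ) : (Pre k n →₀ ℝ) →ₗ[ℝ] ℝ :=
  Finsupp.linearCombination ℝ (dVal k m δ n)

@[simp] theorem pairing_single (m : ℕ → ℕ) (δ : Node k) (n : ℕ) (x : Pre k n) (a : ℝ) :
    pairing m δ n (Finsupp.single x a) = a * dVal k m δ n x := by
  simp [pairing]

theorem pairing_mapDomain_old (m : ℕ → ℕ) (δ : Node k) (n : ℕ) (u : Pre k n →₀ ℝ) :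
    pairing m δ (n + 1) (u.mapDomain Step.old) = pairing m δ n u := by
  simp only [pairing, Finsupp.linearCombination_mapDomain]
  rfl

open Classical in
theorem dVal_new (m : ℕ → ℕ) (δ : Node k) (n : ℕ) (c : Code (Pre k n)) :
    dVal k m δ (n + 1) (Step.new c) =
      (if Pre.toNode (n := n + 1) (Step.new c) = δ then 1 else 0) + pairing m δ n (cFun m c) := by
  rfl

theorem proj_old (m : ℕ → ℕ) (n q : ℕ) (u : Pre k n →₀ ℝ) :
    proj k m (n + 1) q (u.mapDomain Step.old) = (proj k m n q u).mapDomain Step.old := by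
  induction u using Finsupp.induction_linear with
  | zero => simp
  | add f g hf hg => simp only [Finsupp.mapDomain_add, map_add, hf, hg]
  | single x a =>
    rw [Finsupp.mapDomain_single, ← mul_one a, ← smul_eq_mul, ← Finsupp.smul_single,
      ← Finsupp.smul_single, map_smul, map_smul, Finsupp.mapDomain_smul]
    simp [proj]

theorem proj_single_old (m : ℕ → ℕ) (n q : ℕ) (x : Pre k n) :
    proj k m (n + 1) q (Finsupp.single (Step.old x) 1) =
      (proj k m n q (Finsupp.single x 1)).mapDomain Step.old := by
  rw [← proj_old, Finsupp.mapDomain_single]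

theorem proj_single_new (m : ℕ → ℕ) (n q : ℕ) (c : Code (Pre k n)) :
    proj k m (n + 1) q (Finsupp.single (Step.new c) 1) =
      if n + 2 ≤ q then Finsupp.single (Step.new c) 1
      else (proj k m n q (cFun m c)).mapDomain Step.old := by
  simp [proj, cFun]

/-- `P*_{(0,q)}` fixes `e*_x` when `rank x ≤ q`. -/
theorem proj_single_of_rank_le (m : ℕ → ℕ) : ∀ (n q : ℕ) (x : Pre k n), Pre.rank x ≤ q →
    proj k m n q (Finsupp.single x 1) = Finsupp.single x 1
  | 0, q, x, h => by
      have h' : 1 ≤ q := h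
      simp [proj, h']
  | n + 1, q, Step.old x, h => by
      rw [proj_single_old, proj_single_of_rank_le m n q x h, Finsupp.mapDomain_single]
  | n + 1, q, Step.new c, h => by
      rw [proj_single_new]
      exact if_pos h

/-- Two linear maps that agree on the unit vectors of a set agree on the functionals supported
by it. -/
theorem linearMap_eq_of_supported {α M : Type} [AddCommGroup M] [Module ℝ M] {s : Set α}
    {f g : (α →₀ ℝ) →ₗ[ℝ] M} (h : ∀ x ∈ s, f (Finsupp.single x 1) = g (Finsupp.single x 1))
    {u : α →₀ ℝ} (hu : u ∈ Finsupp.supported ℝ ℝ s) : f u = g u := by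
  rw [← Finsupp.sum_single u, Finsupp.sum, map_sum, map_sum]
  refine Finset.sum_congr rfl fun x hx => ?_
  rw [← mul_one (u x), ← smul_eq_mul, ← Finsupp.smul_single, map_smul, map_smul,
    h x ((Finsupp.mem_supported ℝ u).1 hu hx)]

open Classical in
/-- Up to rank `rank δ`, the vector `d_δ` is the indicator of `δ`. -/
theorem dVal_of_rank_le (m : ℕ → ℕ) (δ : Node k) : ∀ (n : ℕ) (x : Pre k n), Pre.rank x ≤ δ.rank →
    dVal k m δ n x = if Pre.toNode x = δ then 1 else 0
  | 0, _, _ => rfl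
  | n + 1, Step.old x, h => dVal_of_rank_le m δ n x h
  | n + 1, Step.new c, h => by
      have h' : n + 2 ≤ δ.rank := h
      have h0 : pairing m δ n = 0 := by
        ext x
        have hx := Pre.rank_le x
        have hne : Pre.toNode x ≠ δ := by
          intro e
          have := Pre.rank_toNode x
          rw [e] at this
          omega
        simp [dVal_of_rank_le m δ n x (by omega), hne]
      rw [dVal_new, h0]
      simp

theorem toNode_ne_of_rank_ne {n : ℕ} {x : Pre k n} {δ : Node k} (h : Pre.rank x ≠ δ.rank) :
    Pre.toNode x ≠ δ := by
  rintro rfl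
  exact h (Pre.rank_toNode x).symm

theorem dVal_of_rank_lt (m : ℕ → ℕ) (δ : Node k) (n : ℕ) (x : Pre k n)
    (h : Pre.rank x < δ.rank) : dVal k m δ n x = 0 := by
  rw [dVal_of_rank_le m δ n x h.le, if_neg (toNode_ne_of_rank_ne h.ne)]

/-- `⟨d_δ, P*_{(0,q)} u⟩` is `⟨d_δ, u⟩` if `rank δ ≤ q`, and `0` otherwise. -/
theorem pairing_proj (m : ℕ → ℕ) (δ : Node k) (q : ℕ) : ∀ (n : ℕ) (u : Pre k n →₀ ℝ),
    pairing m δ n (proj k m n q u) = if δ.rank ≤ q then pairing m δ n u else 0 := by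
  intro n
  suffices h : ∀ x : Pre k n, pairing m δ n (proj k m n q (Finsupp.single x 1)) =
      if δ.rank ≤ q then dVal k m δ n x else 0 by
    intro u
    have : (pairing m δ n ∘ₗ proj k m n q) = if δ.rank ≤ q then pairing m δ n else 0 := by
      ext x
      have := h x
      split_ifs at this ⊢ <;> simpa using this
    have := LinearMap.congr_fun this u
    split_ifs at this ⊢ <;> simpa using this
  have low : ∀ (n : ℕ) (x : Pre k n), Pre.rank x ≤ q →
      pairing m δ n (proj k m n q (Finsupp.single x 1)) =
        if δ.rank ≤ q then dVal k m δ n x else 0 := by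
    intro n x hx
    rw [proj_single_of_rank_le m n q x hx, pairing_single, one_mul]
    split_ifs with h
    · rfl
    · exact dVal_of_rank_lt m δ n x (by omega)
  induction n with
  | zero =>
    intro x
    by_cases hx : Pre.rank x ≤ q
    · exact low 0 x hx
    · have hq : ¬ 1 ≤ q := hx
      have hδ : ¬ δ.rank ≤ q := by
        have : 1 ≤ δ.rank := Nat.le_add_left 1 _
        omega
      simp [proj, hq, hδ]
  | succ n ih =>
    rintro (x | c)
    · rw [proj_single_old, pairing_mapDomain_old, ih x]
      rfl
    · by_cases hx : n + 2 ≤ q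
      · exact low (n + 1) (Step.new c) hx
      · rw [proj_single_new, if_neg hx, pairing_mapDomain_old]
        have : (pairing m δ n ∘ₗ proj k m n q) = if δ.rank ≤ q then pairing m δ n else 0 := by
          ext y
          have := ih y
          split_ifs at this ⊢ <;> simpa using this
        have h1 := LinearMap.congr_fun this (cFun m c)
        rw [LinearMap.comp_apply] at h1
        rw [h1]
        split_ifs with h
        · rw [dVal_new, if_neg, zero_add]
          refine toNode_ne_of_rank_ne (n := n + 1) ?_
          change n + 2 ≠ δ.rank
          omega
        · rfl

theorem l1norm_nonneg {α : Type} (u : α →₀ ℝ) : 0 ≤ l1norm u :=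
  Finset.sum_nonneg fun _ _ => abs_nonneg _

theorem abs_pairing_le (m : ℕ → ℕ) (δ : Node k) (n : ℕ) (u : Pre k n →₀ ℝ)
    (h : ∀ x ∈ u.support, |dVal k m δ n x| ≤ 1) : |pairing m δ n u| ≤ l1norm u := by
  rw [pairing, Finsupp.linearCombination_apply, Finsupp.sum, l1norm, Finsupp.sum]
  refine (Finset.abs_sum_le_sum_abs _ _).trans (Finset.sum_le_sum fun x hx => ?_)
  rw [smul_eq_mul, abs_mul]
  exact mul_le_of_le_one_right (abs_nonneg _) (h x hx)

theorem Growth.one_le_m {m ns : ℕ → ℕ} (h : Growth m ns) {j : ℕ} (hj : 1 ≤ j) : 1 ≤ m j := by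
  have h1 : m 1 ≤ m j := h.m_strictMono.monotoneOn (Set.mem_Ici.2 le_rfl) (Set.mem_Ici.2 hj) hj
  have := h.m_one
  omega

theorem abs_inv_mul_le_one {a : ℕ} (ha : 1 ≤ a) {t : ℝ} (ht : |t| ≤ 1) : |(a : ℝ)⁻¹ * t| ≤ 1 := by
  rw [abs_mul, abs_of_nonneg (by positivity)]
  exact mul_le_one₀ (Nat.cast_inv_le_one a) (abs_nonneg _) ht

/-- The vectors `d_δ` are bounded by `1` on `Γ^max`: at most one of the terms of
`d_δ(γ) = [γ = δ] + ⟨d_δ, c*_γ⟩` survives, by `pairing_proj`. -/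
theorem abs_dVal_le_one {m ns N : ℕ → ℕ} (hg : Growth m ns) (δ : Node k) : ∀ (n : ℕ) (x : Pre k n),
    Pre.InMax ns N x → |dVal k m δ n x| ≤ 1
  | 0, x, _ => by
      by_cases h : Pre.toNode (n := 0) x = δ <;> simp [dVal, h]
  | n + 1, Step.old x, h => abs_dVal_le_one hg δ n x h
  | n + 1, Step.new c, h => by
      by_cases hδ : n + 2 ≤ δ.rank
      · rw [dVal_of_rank_le m δ (n + 1) (Step.new c) hδ]
        split_ifs <;> simp
      have hne : Pre.toNode (n := n + 1) (Step.new c) ≠ δ :=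
        toNode_ne_of_rank_ne (n := n + 1) (by change n + 2 ≠ _; omega)
      rw [dVal_new, if_neg hne, zero_add]
      have hb : ∀ (p : ℕ) (b : Pre k n →₀ ℚ), InB N Pre.rank (Pre.InMax ns N) p (n + 1) b →
          |pairing m δ n (toReal b)| ≤ 1 := fun p b hb =>
        (abs_pairing_le m δ n _ fun x hx =>
          abs_dVal_le_one hg δ n x (hb.1 x (toReal_support b hx)).1).trans hb.2.1
      cases c with
      | one p j b =>
        obtain ⟨-, hj, -, hB⟩ := h
        simp only [cFun, Code.cStar, map_smul, map_sub, pairing_proj, smul_eq_mul]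
        refine abs_inv_mul_le_one (hg.one_le_m hj) ?_
        split_ifs
        · simp
        · simpa using hb p b hB
      | two ξ j b =>
        obtain ⟨hξ, -, hj, -, -, -, hB⟩ := h
        simp only [cFun, Code.cStar, map_smul, map_sub, map_add, pairing_proj, smul_eq_mul,
          pairing_single, one_mul]
        by_cases hr : δ.rank ≤ Pre.rank ξ
        · simpa [hr] using abs_dVal_le_one hg δ n ξ hξ
        · rw [dVal_of_rank_lt m δ n ξ (by omega), if_neg hr, zero_add, sub_zero]
          exact abs_inv_mul_le_one (hg.one_le_m hj) (hb _ b hB)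

/-! ### The partial map `G` and the operator `R*` -/

section RStar

variable {α : Type} (g : α → Option α)

@[simp] theorem rStar_zero : rStar g 0 = 0 := Finsupp.sum_zero_index

theorem rStar_add (b b' : α →₀ ℚ) : rStar g (b + b') = rStar g b + rStar g b' := by
  classical
  refine Finsupp.sum_add_index' (fun x => ?_) fun x a a' => ?_
  · cases g x <;> simp
  · cases g x <;> simp

theorem rStar_single (x : α) (a : ℚ) :
    rStar g (Finsupp.single x a) = (g x).elim 0 fun y => Finsupp.single y a := by
  rw [rStar, Finsupp.sum_single_index]
  · cases g x <;> rfl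
  · cases g x <;> simp

/-- The operator `R*` on real functionals. -/
def shiftFun : (α →₀ ℝ) →ₗ[ℝ] (α →₀ ℝ) :=
  Finsupp.linearCombination ℝ fun x => (g x).elim 0 fun y => Finsupp.single y 1

@[simp] theorem shiftFun_single (x : α) (a : ℝ) :
    shiftFun g (Finsupp.single x a) = (g x).elim 0 fun y => Finsupp.single y a := by
  rw [shiftFun, Finsupp.linearCombination_single]
  cases g x <;> simp

theorem toReal_rStar (b : α →₀ ℚ) : toReal (rStar g b) = shiftFun g (toReal b) := by
  induction b using Finsupp.induction_linear with
  | zero => simp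
  | add b b' h h' => rw [rStar_add, toReal_add, toReal_add, map_add, h, h']
  | single x a =>
    rw [rStar_single, toReal_single, shiftFun_single]
    cases g x <;> simp

/-- The iterates of a partial map. -/
def iter : ℕ → α → Option α
  | 0, x => some x
  | j + 1, x => (iter j x).bind g

theorem rStar_iterate_add (j : ℕ) (b b' : α →₀ ℚ) :
    (rStar g)^[j] (b + b') = (rStar g)^[j] b + (rStar g)^[j] b' := by
  induction j with
  | zero => rfl
  | succ j ih => simp only [Function.iterate_succ_apply', ih, rStar_add]

theorem rStar_iterate_zero (j : ℕ) : (rStar g)^[j] 0 = 0 :=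
  Function.iterate_fixed (rStar_zero g) j

theorem rStar_iterate_single (j : ℕ) (x : α) (a : ℚ) :
    (rStar g)^[j] (Finsupp.single x a) = (iter g j x).elim 0 fun y => Finsupp.single y a := by
  induction j with
  | zero => rfl
  | succ j ih =>
    rw [Function.iterate_succ_apply', ih, iter]
    cases iter g j x with
    | none => simp
    | some y => simpa using rStar_single g y a

theorem rStar_iterate_eq_zero {j : ℕ} (h : ∀ x, iter g j x = none) (b : α →₀ ℚ) :
    (rStar g)^[j] b = 0 := by
  induction b using Finsupp.induction_linear with
  | zero => exact rStar_iterate_zero g j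
  | add b b' hb hb' => rw [rStar_iterate_add, hb, hb', add_zero]
  | single x a => rw [rStar_iterate_single, h x]; rfl

theorem exists_of_mem_support_rStar {b : α →₀ ℚ} {y : α} (hy : y ∈ (rStar g b).support) :
    ∃ x ∈ b.support, g x = some y := by
  classical
  obtain ⟨x, hx, hxy⟩ := Finset.mem_biUnion.1 (Finsupp.support_sum hy)
  refine ⟨x, hx, ?_⟩
  cases hg : g x with
  | none => simp [hg] at hxy
  | some z =>
    simp only [hg] at hxy
    rw [Finset.mem_singleton.1 (Finsupp.support_single_subset hxy)]

theorem l1norm_add_le {α : Type} (u v : α →₀ ℝ) : l1norm (u + v) ≤ l1norm u + l1norm v := by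
  classical
  have h : ∀ w : α →₀ ℝ, w.support ⊆ u.support ∪ v.support →
      l1norm w = ∑ x ∈ u.support ∪ v.support, |w x| := fun w hw =>
    Finsupp.sum_of_support_subset w hw _ fun _ _ => abs_zero
  rw [h _ Finsupp.support_add, h u Finset.subset_union_left, h v Finset.subset_union_right,
    ← Finset.sum_add_distrib]
  exact Finset.sum_le_sum fun x _ => abs_add_le _ _

theorem l1norm_single {α : Type} (x : α) (a : ℝ) : l1norm (Finsupp.single x a) = |a| :=
  Finsupp.sum_single_index abs_zero

theorem l1norm_sum_le {α ι : Type} (s : Finset ι) (u : ι → α →₀ ℝ) :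
    l1norm (∑ i ∈ s, u i) ≤ ∑ i ∈ s, l1norm (u i) :=
  Finset.le_sum_of_subadditive l1norm (le_of_eq Finsupp.sum_zero_index) l1norm_add_le s u

theorem l1norm_shiftFun_le (u : α →₀ ℝ) : l1norm (shiftFun g u) ≤ l1norm u := by
  conv_lhs => rw [← Finsupp.sum_single u, Finsupp.sum, map_sum]
  refine (l1norm_sum_le _ _).trans (Finset.sum_le_sum fun x _ => ?_)
  rw [shiftFun_single]
  cases g x with
  | none => exact Finsupp.sum_zero_index.trans_le (abs_nonneg _)
  | some y => exact (l1norm_single y _).le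

/-- The rational numbers whose denominators divide `M` are closed under addition. -/
theorem den_add_dvd {M : ℕ} {a b : ℚ} (ha : a.den ∣ M) (hb : b.den ∣ M) : (a + b).den ∣ M := by
  have key : ∀ q : ℚ, q.den ∣ M ↔ ∃ z : ℤ, q * M = z := by
    intro q
    constructor
    · rintro ⟨t, rfl⟩
      refine ⟨q.num * t, ?_⟩
      push_cast
      rw [← mul_assoc, Rat.mul_den_eq_num]
    · rintro ⟨z, hz⟩
      rcases Nat.eq_zero_or_pos M with rfl | hM
      · exact dvd_zero _
      have hq : q = Rat.divInt z M := by
        rw [Rat.divInt_eq_div, eq_div_iff (by exact_mod_cast hM.ne')]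
        exact_mod_cast hz
      rw [hq]
      exact_mod_cast Rat.den_dvd z M
  rw [key] at *
  obtain ⟨y, hy⟩ := ha
  obtain ⟨z, hz⟩ := hb
  exact ⟨y + z, by push_cast; rw [add_mul, hy, hz]⟩

theorem den_rStar_dvd {M : ℕ} {b : α →₀ ℚ} (hb : ∀ x, (b x).den ∣ M) (y : α) :
    (rStar g b y).den ∣ M := by
  classical
  rw [rStar, Finsupp.sum, Finsupp.finsetSum_apply]
  refine Finset.sum_induction _ (fun q : ℚ => q.den ∣ M) (fun _ _ => den_add_dvd) (by simp) ?_
  intro x _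
  cases g x with
  | none => simp
  | some z =>
    simp only [Finsupp.single_apply]
    split_ifs
    · exact hb x
    · simp

end RStar

theorem Pre.G_old (m : ℕ → ℕ) {n : ℕ} (x : Pre k n) :
    Pre.G m (n := n + 1) (Step.old x) = (Pre.G m x).map Step.old := by
  simp [Pre.G]

/-- The operator `I - P*_{(0,q)}`, at a rational functional. -/
def tail (m : ℕ → ℕ) (n q : ℕ) (b : Pre k n →₀ ℚ) : Pre k n →₀ ℝ :=
  toReal b - proj k m n q (toReal b)

open Classical in
theorem Pre.G_one (m : ℕ → ℕ) {n : ℕ} (p j : ℕ) (b : Pre k n →₀ ℚ) :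
    Pre.G m (n := n + 1) (Step.new (Code.one p j b)) =
      if tail m n p (rStar (Pre.G m) b) = 0 then none
      else some (Step.new (Code.one p j (rStar (Pre.G m) b))) := by
  simp only [Pre.G, tail]
  congr

theorem Pre.G_two_of_some (m : ℕ → ℕ) {n : ℕ} {ξ ξ' : Pre k n} (h : Pre.G m ξ = some ξ') (j : ℕ)
    (b : Pre k n →₀ ℚ) :
    Pre.G m (n := n + 1) (Step.new (Code.two ξ j b)) =
      some (Step.new (Code.two ξ' j (rStar (Pre.G m) b))) := by
  simp [Pre.G, h]

open Classical in
theorem Pre.G_two_of_none (m : ℕ → ℕ) {n : ℕ} {ξ : Pre k n} (h : Pre.G m ξ = none) (j : ℕ)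
    (b : Pre k n →₀ ℚ) :
    Pre.G m (n := n + 1) (Step.new (Code.two ξ j b)) =
      if tail m n (Pre.rank ξ) (rStar (Pre.G m) b) = 0 then none
      else some (Step.new (Code.one (Pre.rank ξ) j (rStar (Pre.G m) b))) := by
  simp only [Pre.G, h, tail]
  congr

/-- The possible values of `G` at a new element. -/
theorem Pre.G_new_cases (m : ℕ → ℕ) {n : ℕ} {c : Code (Pre k n)} {y : Pre k (n + 1)}
    (h : Pre.G m (n := n + 1) (Step.new c) = some y) :
    (∃ p j b, c = Code.one p j b ∧ y = Step.new (Code.one p j (rStar (Pre.G m) b)) ∧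
      tail m n p (rStar (Pre.G m) b) ≠ 0) ∨
    (∃ ξ ξ' j b, c = Code.two ξ j b ∧ Pre.G m ξ = some ξ' ∧
      y = Step.new (Code.two ξ' j (rStar (Pre.G m) b))) ∨
    (∃ ξ j b, c = Code.two ξ j b ∧ Pre.G m ξ = none ∧
      y = Step.new (Code.one (Pre.rank ξ) j (rStar (Pre.G m) b)) ∧
      tail m n (Pre.rank ξ) (rStar (Pre.G m) b) ≠ 0) := by
  cases c with
  | one p j b =>
    left
    rw [Pre.G_one] at h
    split_ifs at h with h0
    exact ⟨p, j, b, rfl, (Option.some.inj h).symm, h0⟩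
  | two ξ j b =>
    right
    cases hξ : Pre.G m ξ with
    | some ξ' =>
      left
      rw [Pre.G_two_of_some m hξ] at h
      exact ⟨ξ, ξ', j, b, rfl, hξ, (Option.some.inj h).symm⟩
    | none =>
      right
      rw [Pre.G_two_of_none m hξ] at h
      split_ifs at h with h0
      exact ⟨ξ, j, b, rfl, hξ, (Option.some.inj h).symm, h0⟩

theorem Pre.rank_G (m : ℕ → ℕ) : ∀ {n : ℕ} {x y : Pre k n}, Pre.G m x = some y →
    Pre.rank y = Pre.rank x
  | 0, _, _, _ => rfl
  | n + 1, Step.old x, y, h => by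
      rw [Pre.G_old, Option.map_eq_some_iff] at h
      obtain ⟨z, hz, rfl⟩ := h
      exact Pre.rank_G m (n := n) hz
  | n + 1, Step.new c, y, h => by
      rcases Pre.G_new_cases m h with ⟨_, _, _, -, rfl, -⟩ | ⟨_, _, _, _, -, -, rfl⟩ |
        ⟨_, _, _, -, -, rfl, -⟩ <;> rfl

theorem Pre.weightIdx_G (m : ℕ → ℕ) : ∀ {n : ℕ} {x y : Pre k n}, Pre.G m x = some y →
    Pre.weightIdx y = Pre.weightIdx x
  | 0, _, _, _ => rfl
  | n + 1, Step.old x, y, h => by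
      rw [Pre.G_old, Option.map_eq_some_iff] at h
      obtain ⟨z, hz, rfl⟩ := h
      exact Pre.weightIdx_G m (n := n) hz
  | n + 1, Step.new c, y, h => by
      rcases Pre.G_new_cases m h with ⟨_, _, _, rfl, rfl, -⟩ | ⟨_, _, _, _, rfl, -, rfl⟩ |
        ⟨_, _, _, rfl, -, rfl, -⟩ <;> rfl

theorem Pre.age_G_le (m : ℕ → ℕ) : ∀ {n : ℕ} {x y : Pre k n}, Pre.G m x = some y →
    Pre.age y ≤ Pre.age x
  | 0, _, _, _ => le_rfl
  | n + 1, Step.old x, y, h => by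
      rw [Pre.G_old, Option.map_eq_some_iff] at h
      obtain ⟨z, hz, rfl⟩ := h
      exact Pre.age_G_le m (n := n) hz
  | n + 1, Step.new c, y, h => by
      rcases Pre.G_new_cases m h with ⟨_, _, _, rfl, rfl, -⟩ | ⟨_, _, _, _, rfl, hξ, rfl⟩ |
        ⟨_, _, _, rfl, -, rfl, -⟩
      · exact le_rfl
      · exact Nat.add_le_add_left (Pre.age_G_le m hξ) 1
      · exact Nat.le_add_right 1 _

theorem iter_G_old (m : ℕ → ℕ) {n : ℕ} (j : ℕ) (x : Pre k n) :
    iter (Pre.G m (n := n + 1)) j (Step.old x) = (iter (Pre.G m) j x).map Step.old := by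
  induction j with
  | zero => rfl
  | succ j ih =>
    rw [iter, ih, iter]
    cases iter (Pre.G m) j x with
    | none => rfl
    | some y => exact Pre.G_old m y

theorem iterG_toNode (m : ℕ → ℕ) {n : ℕ} (j : ℕ) (x : Pre k n) :
    Node.iterG m j (Pre.toNode x) = (iter (Pre.G m) j x).map Pre.toNode := by
  induction j with
  | zero => rfl
  | succ j ih =>
    rw [iter, Node.iterG, ih]
    cases iter (Pre.G m) j x with
    | none => rfl
    | some y => exact Node.G_toNode m y

/-- The map `G` is nilpotent of order `k`, and so is `R*`. At a new element, `G^k` could only be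
defined through `G^k ξ`, or through a nonzero tail of `(R*)^k b`. -/
theorem iter_G_eq_none (hk : 0 < k) (m : ℕ → ℕ) : ∀ (n : ℕ) (x : Pre k n),
    iter (Pre.G m) k x = none := by
  intro n
  induction n with
  | zero =>
    intro x
    have h : ∀ j y, iter (Pre.G m (n := 0)) j x = some y → y.val + j = x.val := by
      intro j
      induction j with
      | zero => rintro y ⟨⟩; rfl
      | succ j ih =>
        intro y hy
        rw [iter, Option.bind_eq_some_iff] at hy
        obtain ⟨z, hz, hzy⟩ := hy
        have h1 := ih z hz
        simp only [Pre.G] at hzy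
        split_ifs at hzy with h0
        cases Option.some.inj hzy
        simp only
        omega
    by_contra hne
    obtain ⟨y, hy⟩ := Option.ne_none_iff_exists'.1 hne
    have := h k y hy
    have := x.isLt
    omega
  | succ n ih =>
    have hR := rStar_iterate_eq_zero (Pre.G m (n := n)) ih
    have htail : ∀ q, tail m n q (0 : Pre k n →₀ ℚ) = 0 := fun q => by simp [tail]
    -- The orbits of Type 1 and Type 2 elements; a Type 2 orbit may turn into a Type 1 orbit.
    have h1 : ∀ (p j : ℕ) (b : Pre k n →₀ ℚ) (i : ℕ) (y : Pre k (n + 1)),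
        iter (Pre.G m (n := n + 1)) i (Step.new (Code.one p j b)) = some y →
          y = Step.new (Code.one p j ((rStar (Pre.G m))^[i] b)) ∧
            (i = 0 ∨ tail m n p ((rStar (Pre.G m))^[i] b) ≠ 0) := by
      intro p j b i
      induction i with
      | zero => rintro y ⟨⟩; exact ⟨rfl, Or.inl rfl⟩
      | succ i ihi =>
        intro y hy
        rw [iter, Option.bind_eq_some_iff] at hy
        obtain ⟨z, hz, hzy⟩ := hy
        obtain ⟨rfl, -⟩ := ihi z hz
        rw [Pre.G_one] at hzy
        split_ifs at hzy with h0
        rw [Function.iterate_succ_apply']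
        exact ⟨(Option.some.inj hzy).symm, Or.inr h0⟩
    have h2 : ∀ (ξ : Pre k n) (j : ℕ) (b : Pre k n →₀ ℚ) (i : ℕ) (y : Pre k (n + 1)),
        iter (Pre.G m (n := n + 1)) i (Step.new (Code.two ξ j b)) = some y →
          (∃ ξ', iter (Pre.G m) i ξ = some ξ' ∧
            y = Step.new (Code.two ξ' j ((rStar (Pre.G m))^[i] b))) ∨
          ∃ p, y = Step.new (Code.one p j ((rStar (Pre.G m))^[i] b)) ∧
            tail m n p ((rStar (Pre.G m))^[i] b) ≠ 0 := by
      intro ξ j b i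
      induction i with
      | zero => rintro y ⟨⟩; exact Or.inl ⟨ξ, rfl, rfl⟩
      | succ i ihi =>
        intro y hy
        rw [iter, Option.bind_eq_some_iff] at hy
        obtain ⟨z, hz, hzy⟩ := hy
        rw [Function.iterate_succ_apply']
        rcases ihi z hz with ⟨ξ', hξ', rfl⟩ | ⟨p, rfl, -⟩
        · cases hG : Pre.G m ξ' with
          | some ξ'' =>
            rw [Pre.G_two_of_some m hG] at hzy
            refine Or.inl ⟨ξ'', ?_, (Option.some.inj hzy).symm⟩
            rw [iter, hξ']
            exact hG
          | none =>
            rw [Pre.G_two_of_none m hG] at hzy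
            split_ifs at hzy with h0
            exact Or.inr ⟨_, (Option.some.inj hzy).symm, h0⟩
        · rw [Pre.G_one] at hzy
          split_ifs at hzy with h0
          exact Or.inr ⟨p, (Option.some.inj hzy).symm, h0⟩
    rintro (x | c)
    · rw [iter_G_old, ih x]
      rfl
    · by_contra hne
      obtain ⟨y, hy⟩ := Option.ne_none_iff_exists'.1 hne
      cases c with
      | one p j b =>
        rcases (h1 p j b k y hy).2 with h0 | h0
        · omega
        · exact h0 (by rw [hR, htail])
      | two ξ j b =>
        rcases h2 ξ j b k y hy with ⟨ξ', hξ', -⟩ | ⟨p, -, h0⟩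
        · rw [ih ξ] at hξ'
          cases hξ'
        · exact h0 (by rw [hR, htail])

/-! ### `G` leaves `Γ` invariant -/

theorem InB.rStar {α : Type} {N : ℕ → ℕ} {rank : α → ℕ} {M : α → Prop} {p r : ℕ} {b : α →₀ ℚ}
    {g : α → Option α} (hb : InB N rank M p r b)
    (hM : ∀ x y, g x = some y → M x → M y) (hr : ∀ x y, g x = some y → rank y = rank x) :
    InB N rank M p r (rStar g b) := by
  refine ⟨fun y hy => ?_, ?_, den_rStar_dvd g hb.2.2⟩
  · obtain ⟨x, hx, hxy⟩ := exists_of_mem_support_rStar g hy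
    rw [hr x y hxy]
    exact ⟨hM x y hxy (hb.1 x hx).1, (hb.1 x hx).2⟩
  · rw [toReal_rStar]
    exact (l1norm_shiftFun_le g _).trans hb.2.1

theorem inMax_G (m ns N : ℕ → ℕ) : ∀ {n : ℕ} {x y : Pre k n}, Pre.G m x = some y →
    Pre.InMax ns N x → Pre.InMax ns N y
  | 0, _, _, _, _ => trivial
  | n + 1, Step.old x, y, h, hx => by
      rw [Pre.G_old, Option.map_eq_some_iff] at h
      obtain ⟨z, hz, rfl⟩ := h
      exact inMax_G m ns N (n := n) hz hx
  | n + 1, Step.new c, y, h, hx => by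
      have hB : ∀ {p : ℕ} {b : Pre k n →₀ ℚ}, InB N Pre.rank (Pre.InMax ns N) p (n + 1) b →
          InB N Pre.rank (Pre.InMax ns N) p (n + 1) (rStar (Pre.G m) b) := fun hb =>
        hb.rStar (fun _ _ h hx => inMax_G m ns N h hx) fun _ _ => Pre.rank_G m
      rcases Pre.G_new_cases m h with ⟨p, j, b, rfl, rfl, -⟩ | ⟨ξ, ξ', j, b, rfl, hξ, rfl⟩ |
        ⟨ξ, j, b, rfl, -, rfl, -⟩
      · obtain ⟨h1, h2, h3, h4⟩ := hx
        exact ⟨h1, h2, h3, hB h4⟩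
      · obtain ⟨h1, h2, h3, h4, h5, h6, h7⟩ := hx
        have hr := Pre.rank_G m hξ
        refine ⟨inMax_G m ns N hξ h1, hr ▸ h2, h3, hr ▸ h4, (Pre.weightIdx_G m hξ).trans h5,
          (Pre.age_G_le m hξ).trans_lt h6, ?_⟩
        rw [hr]
        exact hB h7
      · obtain ⟨h1, h2, h3, h4, h5, h6, h7⟩ := hx
        exact ⟨h2, h3, by omega, hB h7⟩

/-- `Σ(ξ) ⊆ Σ(G ξ)`, because `G^k` is nowhere defined. -/
theorem sigmaSet_subset_G (hk : 0 < k) {m ns N : ℕ → ℕ} (σ : GammaMax k ns N → ℕ) {n : ℕ}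
    {ξ ξ' : Pre k n} (h : Pre.G m ξ = some ξ') :
    sigmaSet m ns N σ (Pre.toNode ξ) ⊆ sigmaSet m ns N σ (Pre.toNode ξ') := by
  rintro s ⟨δ, i, hi, hδ, rfl⟩
  have hstep : Node.iterG m (i + 1) δ.1 = some (Pre.toNode ξ') := by
    rw [Node.iterG, hδ, Option.bind_some, Node.G_toNode, h]
    rfl
  refine ⟨δ, i + 1, lt_of_le_of_ne hi ?_, hstep, rfl⟩
  rintro hik
  have hδ' : δ.1 = Pre.toNode δ.1.2.toPre := (Fresh.toNode_toPre δ.1.2).symm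
  rw [hδ', iterG_toNode, show i + 1 = k from hik, iter_G_eq_none hk] at hstep
  cases hstep

theorem inGammaAux_G (hk : 0 < k) {m ns N : ℕ → ℕ} (σ : GammaMax k ns N → ℕ) :
    ∀ {n : ℕ} {x y : Pre k n}, Pre.G m x = some y →
      Pre.InGammaAux m ns N σ x → Pre.InGammaAux m ns N σ y
  | 0, _, _, _, _ => trivial
  | n + 1, Step.old x, y, h, hx => by
      rw [Pre.G_old, Option.map_eq_some_iff] at h
      obtain ⟨z, hz, rfl⟩ := h
      exact inGammaAux_G hk σ (n := n) hz hx
  | n + 1, Step.new c, y, h, hx => by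
      have hsupp : ∀ {b : Pre k n →₀ ℚ}, (∀ η ∈ b.support, Pre.InGammaAux m ns N σ η) →
          ∀ η ∈ (rStar (Pre.G m) b).support, Pre.InGammaAux m ns N σ η := by
        intro b hb η hη
        obtain ⟨x, hx, hxη⟩ := exists_of_mem_support_rStar _ hη
        exact inGammaAux_G hk σ hxη (hb x hx)
      -- The condition on odd weights; `Q` and `Q'` are what it demands of `i` besides `weightIdx`.
      have hodd : ∀ {b : Pre k n →₀ ℚ} {Q Q' : ℕ → Prop}, (∀ i, Q i → Q' i) →
          (b = 0 ∨ ∃ η, b = Finsupp.single η 1 ∧ ∃ i, Pre.weightIdx η = some (4 * i) ∧ Q i) →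
          (rStar (Pre.G m) b = 0 ∨ ∃ η, rStar (Pre.G m) b = Finsupp.single η 1 ∧
            ∃ i, Pre.weightIdx η = some (4 * i) ∧ Q' i) := by
        rintro b Q Q' hQ (rfl | ⟨η, rfl, i, hi, hQi⟩)
        · exact Or.inl (rStar_zero _)
        · rw [rStar_single]
          cases hη : Pre.G m η with
          | none => exact Or.inl rfl
          | some η' =>
            exact Or.inr ⟨η', rfl, i, (Pre.weightIdx_G m hη).trans hi, hQ i hQi⟩
      rcases Pre.G_new_cases m h with ⟨p, j, b, rfl, rfl, -⟩ | ⟨ξ, ξ', j, b, rfl, hξ, rfl⟩ |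
        ⟨ξ, j, b, rfl, -, rfl, -⟩
      · exact ⟨hsupp hx.1, fun hj => hodd (fun _ h => h) (hx.2 hj)⟩
      · exact ⟨inGammaAux_G hk σ hξ hx.1, hsupp hx.2.1,
          fun hj => hodd (fun _ h => ⟨h.1, sigmaSet_subset_G hk σ hξ h.2⟩) (hx.2.2 hj)⟩
      · exact ⟨hsupp hx.2.1, fun hj => hodd (fun _ h => h.1) (hx.2.2 hj)⟩

/-! ### `R*` commutes with the projections -/

/-- The operator `R*` on real functionals on the elements of rank at most `n + 1`. -/
abbrev shiftPre (m : ℕ → ℕ) (n : ℕ) : (Pre k n →₀ ℝ) →ₗ[ℝ] (Pre k n →₀ ℝ) :=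
  shiftFun (Pre.G m)

theorem shiftPre_mapDomain_old (m : ℕ → ℕ) (n : ℕ) (u : Pre k n →₀ ℝ) :
    shiftPre m (n + 1) (u.mapDomain Step.old) = (shiftPre m n u).mapDomain Step.old := by
  induction u using Finsupp.induction_linear with
  | zero => simp
  | add f g hf hg => simp only [Finsupp.mapDomain_add, map_add, hf, hg]
  | single x a =>
    rw [Finsupp.mapDomain_single, shiftFun_single, shiftFun_single, Pre.G_old]
    cases Pre.G m x <;> simp

theorem tail_rStar {m : ℕ → ℕ} {n : ℕ}
    (hcomm : ∀ q u, proj k m n q (shiftPre m n u) = shiftPre m n (proj k m n q u))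
    (q : ℕ) (b : Pre k n →₀ ℚ) :
    tail m n q (rStar (Pre.G m) b) = shiftPre m n (tail m n q b) := by
  rw [tail, tail, toReal_rStar, map_sub, hcomm]

/-- `R* c*_γ` is `c*_{G γ}`, or `0` if `G γ` is undefined, as soon as `R*` commutes with the
projections on the functionals of lower rank. -/
theorem shiftPre_cFun_of_comm {m : ℕ → ℕ} {n : ℕ}
    (hcomm : ∀ q u, proj k m n q (shiftPre m n u) = shiftPre m n (proj k m n q u))
    (c : Code (Pre k n)) :
    (Pre.G m (n := n + 1) (Step.new c) = none ∧ shiftPre m n (cFun m c) = 0) ∨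
      ∃ c', Pre.G m (n := n + 1) (Step.new c) = some (Step.new c') ∧
        shiftPre m n (cFun m c) = cFun m c' := by
  have ht := tail_rStar hcomm
  have hone : ∀ p j b, cFun m (Code.one p j b : Code (Pre k n)) = (m j : ℝ)⁻¹ • tail m n p b :=
    fun _ _ _ => rfl
  have htwo : ∀ ξ j b, cFun m (Code.two ξ j b : Code (Pre k n)) =
      Finsupp.single ξ 1 + (m j : ℝ)⁻¹ • tail m n (Pre.rank ξ) b := fun _ _ _ => rfl
  cases c with
  | one p j b =>
    rw [Pre.G_one, hone, map_smul, ← ht]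
    by_cases h0 : tail m n p (rStar (Pre.G m) b) = 0
    · rw [if_pos h0, h0, smul_zero]
      exact Or.inl ⟨rfl, rfl⟩
    · rw [if_neg h0]
      exact Or.inr ⟨_, rfl, rfl⟩
  | two ξ j b =>
    rw [htwo, map_add, map_smul, ← ht, shiftFun_single]
    cases hξ : Pre.G m ξ with
    | some ξ' =>
      rw [Pre.G_two_of_some m hξ]
      refine Or.inr ⟨_, rfl, ?_⟩
      rw [htwo, Pre.rank_G m hξ]
      rfl
    | none =>
      rw [Pre.G_two_of_none m hξ, Option.elim_none, zero_add]
      by_cases h0 : tail m n (Pre.rank ξ) (rStar (Pre.G m) b) = 0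
      · rw [if_pos h0, h0, smul_zero]
        exact Or.inl ⟨rfl, rfl⟩
      · rw [if_neg h0]
        exact Or.inr ⟨_, rfl, rfl⟩

theorem proj_shiftPre (m : ℕ → ℕ) (n : ℕ) : ∀ (q : ℕ) (u : Pre k n →₀ ℝ),
    proj k m n q (shiftPre m n u) = shiftPre m n (proj k m n q u) := by
  induction n with
  | zero =>
    intro q u
    by_cases hq : 1 ≤ q <;> simp [proj, hq]
  | succ n ih =>
    intro q u
    suffices h : ∀ x : Pre k (n + 1), proj k m (n + 1) q (shiftPre m (n + 1) (Finsupp.single x 1)) =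
        shiftPre m (n + 1) (proj k m (n + 1) q (Finsupp.single x 1)) by
      exact linearMap_eq_of_supported (s := Set.univ)
        (f := proj k m (n + 1) q ∘ₗ shiftPre m (n + 1))
        (g := shiftPre m (n + 1) ∘ₗ proj k m (n + 1) q) (fun x _ => h x)
        (by rw [Finsupp.supported_univ]; trivial)
    rintro (x | c)
    · rw [← Finsupp.mapDomain_single, shiftPre_mapDomain_old, proj_old, proj_old,
        shiftPre_mapDomain_old, ih]
    · rw [proj_single_new]
      rcases shiftPre_cFun_of_comm ih c with ⟨hG, hc⟩ | ⟨c', hG, hc⟩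
      · rw [shiftFun_single, hG]
        split_ifs
        · simp [hG]
        · rw [shiftPre_mapDomain_old, ← ih, hc]
          simp
      · rw [shiftFun_single, hG, Option.elim_some, proj_single_new]
        split_ifs
        · rw [shiftFun_single, hG, Option.elim_some]
        · rw [shiftPre_mapDomain_old, ← ih, hc]

theorem shiftPre_cFun (m : ℕ → ℕ) {n : ℕ} (c : Code (Pre k n)) :
    (Pre.G m (n := n + 1) (Step.new c) = none ∧ shiftPre m n (cFun m c) = 0) ∨
      ∃ c', Pre.G m (n := n + 1) (Step.new c) = some (Step.new c') ∧
        shiftPre m n (cFun m c) = cFun m c' :=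
  shiftPre_cFun_of_comm (proj_shiftPre m n) c

/-! ### The sets `Γ^max ∩ Δ_n` are finite -/

/-- A rational number `q` with denominator dividing `M` and `|q| ≤ 1` is `z / M` for some integer
`z` with `|z| ≤ M`. -/
theorem finite_rat_den_dvd {M : ℕ} (hM : 0 < M) : {q : ℚ | q.den ∣ M ∧ |(q : ℝ)| ≤ 1}.Finite := by
  refine ((Set.finite_Icc (-M : ℤ) M).image fun z : ℤ => (z : ℚ) / M).subset ?_
  rintro q ⟨⟨t, rfl⟩, h1⟩
  have h1' : |q| ≤ 1 := by exact_mod_cast h1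
  have ht : 0 < t := Nat.pos_of_mul_pos_left hM
  have hden : (0 : ℚ) < q.den := by exact_mod_cast q.pos
  have ht' : (0 : ℚ) < t := by exact_mod_cast ht
  have hq : ((q.num * t : ℤ) : ℚ) = q * (q.den * t : ℕ) := by
    push_cast
    rw [← mul_assoc, Rat.mul_den_eq_num]
  have hpos : (0 : ℚ) < (q.den * t : ℕ) := by exact_mod_cast hM
  obtain ⟨h2, h3⟩ := abs_le.1 h1'
  refine ⟨q.num * t, ⟨?_, ?_⟩, ?_⟩
  · have : (-(q.den * t : ℕ) : ℚ) ≤ (q.num * t : ℤ) := by rw [hq]; nlinarith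
    exact_mod_cast this
  · have : ((q.num * t : ℤ) : ℚ) ≤ (q.den * t : ℕ) := by rw [hq]; nlinarith
    exact_mod_cast this
  · simp only
    rw [hq, mul_div_assoc, div_self hpos.ne', mul_one]

theorem abs_apply_le_l1norm {α : Type} (u : α →₀ ℝ) (x : α) : |u x| ≤ l1norm u := by
  by_cases hx : x ∈ u.support
  · exact Finset.single_le_sum (f := fun y => |u y|) (fun _ _ => abs_nonneg _) hx
  · rw [Finsupp.notMem_support_iff.1 hx, abs_zero]
    exact l1norm_nonneg u

theorem finite_inB {α : Type} (N : ℕ → ℕ) (rank : α → ℕ) {M : α → Prop} (hM : {x | M x}.Finite)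
    (r : ℕ) : {b : α →₀ ℚ | ∃ p, InB N rank M p r b}.Finite := by
  classical
  refine (Finset.finite_toSet (hM.toFinset.finsupp fun _ =>
    (finite_rat_den_dvd (N r).factorial_pos).toFinset)).subset ?_
  rintro b ⟨p, h1, h2, h3⟩
  refine Finset.mem_finsupp_iff.2 ⟨fun x hx => hM.mem_toFinset.2 (h1 x hx).1, fun x _ => ?_⟩
  exact (Set.Finite.mem_toFinset _).2 ⟨h3 x, (abs_apply_le_l1norm (toReal b) x).trans h2⟩

theorem finite_inMax (ns N : ℕ → ℕ) : ∀ n : ℕ, {x : Pre k n | Pre.InMax ns N x}.Finite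
  | 0 => (Set.toFinite (Set.univ : Set (Fin k))).subset (Set.subset_univ _)
  | n + 1 => by
      have ih : {x : Pre k n | Pre.InMax ns N x}.Finite := finite_inMax ns N n
      have hB := finite_inB N Pre.rank ih (n + 1)
      have h1 := ((Set.finite_Iio (n + 1)).prod ((Set.finite_Iic (n + 2)).prod hB)).image
        fun t : ℕ × ℕ × (Pre k n →₀ ℚ) => (Step.new (Code.one t.1 t.2.1 t.2.2) : Step (Pre k n))
      have h2 := (ih.prod ((Set.finite_Iic (n + 1)).prod hB)).image
        fun t : Pre k n × ℕ × (Pre k n →₀ ℚ) =>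
          (Step.new (Code.two t.1 t.2.1 t.2.2) : Step (Pre k n))
      refine ((ih.image Step.old).union (h1.union h2)).subset ?_
      rintro (x | (⟨p, j, b⟩ | ⟨ξ, j, b⟩)) hx
      · exact Or.inl ⟨x, hx, rfl⟩
      · obtain ⟨hp, -, hj, hb⟩ := hx
        exact Or.inr (Or.inl ⟨(p, j, b), ⟨hp, hj, p, hb⟩, rfl⟩)
      · obtain ⟨hξ, hr, -, hj, -, -, hb⟩ := hx
        exact Or.inr (Or.inr ⟨(ξ, j, b), ⟨hξ, hj.trans hr.le, _, hb⟩, rfl⟩)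

/-! ### The image of `d_δ` under the shift -/

/-- Membership in `Γ` of an element given as one of rank at most `n + 1`. -/
def Pre.InGamma {m ns N : ℕ → ℕ} (σ : GammaMax k ns N → ℕ) {n : ℕ} (x : Pre k n) : Prop :=
  Pre.InMax ns N x ∧ Pre.InGammaAux m ns N σ x

/-- An element of `Γ` given as one of rank at most `n + 1`. -/
def Pre.toGamma {m ns N : ℕ → ℕ} (σ : GammaMax k ns N → ℕ) {n : ℕ} (x : Pre k n)
    (hx : Pre.InGamma (m := m) σ x) : Gamma k m ns N σ :=
  ⟨Pre.toNode x, (inMax_toNode ns N x).2 hx.1, (inGammaAux_toNode σ x).2 hx.2⟩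

theorem finite_gamma_rank (m ns N : ℕ → ℕ) (σ : GammaMax k ns N → ℕ) (r : ℕ) :
    {γ : Gamma k m ns N σ | γ.1.rank = r}.Finite := by
  cases r with
  | zero => exact Set.finite_empty.subset fun γ hγ => absurd hγ (Nat.succ_ne_zero _)
  | succ n =>
    refine Set.Finite.of_finite_image (f := Subtype.val)
      (((finite_inMax (k := k) ns N n).image Pre.toNode).subset ?_) Subtype.val_injective.injOn
    rintro _ ⟨⟨⟨n', c⟩, h⟩, hr, rfl⟩
    obtain rfl : n' = n := Nat.succ_injective hr
    exact ⟨c.toPre, h.1, Fresh.toNode_toPre c⟩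

theorem Node.rank_G {m : ℕ → ℕ} {γ δ : Node k} (h : Node.G m γ = some δ) : δ.rank = γ.rank := by
  rw [Node.G, Option.map_eq_some_iff] at h
  obtain ⟨y, hy, rfl⟩ := h
  rw [Pre.rank_toNode, Pre.rank_G m hy, ← Pre.rank_toNode, Fresh.toNode_toPre]
  rfl

theorem finite_gamma_G (m ns N : ℕ → ℕ) (σ : GammaMax k ns N → ℕ) (δ : Node k) :
    {γ : Gamma k m ns N σ | Node.G m γ.1 = some δ}.Finite :=
  (finite_gamma_rank m ns N σ δ.rank).subset fun _ hγ => (Node.rank_G hγ).symm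

variable {m ns N : ℕ → ℕ} (σ : GammaMax k ns N → ℕ)

/-- The functionals supported by the elements of `Γ` of rank at most `n + 1`. -/
def gammaFun (m : ℕ → ℕ) {ns N : ℕ → ℕ} (σ : GammaMax k ns N → ℕ) (n : ℕ) :
    Submodule ℝ (Pre k n →₀ ℝ) :=
  Finsupp.supported ℝ ℝ {x | Pre.InGamma (m := m) σ x}

theorem mapDomain_old_mem {n : ℕ} {u : Pre k n →₀ ℝ} (hu : u ∈ gammaFun m σ n) :
    u.mapDomain Step.old ∈ gammaFun m σ (n + 1) := by
  classical
  intro y hy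
  obtain ⟨x, hx, rfl⟩ := Finset.mem_image.1 (Finsupp.mapDomain_support hy)
  exact hu hx

theorem toReal_mem {n : ℕ} {b : Pre k n →₀ ℚ} (h : ∀ x ∈ b.support, Pre.InGamma (m := m) σ x) :
    toReal b ∈ gammaFun m σ n := fun x hx => h x (toReal_support b hx)

theorem linearMap_mem_of_supported {α M : Type} [AddCommGroup M] [Module ℝ M] {s : Set α}
    {V : Submodule ℝ M} {f : (α →₀ ℝ) →ₗ[ℝ] M} (h : ∀ x ∈ s, f (Finsupp.single x 1) ∈ V)
    {u : α →₀ ℝ} (hu : u ∈ Finsupp.supported ℝ ℝ s) : f u ∈ V := by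
  rw [← Finsupp.sum_single u, Finsupp.sum, map_sum]
  refine V.sum_mem fun x hx => ?_
  rw [← mul_one (u x), ← smul_eq_mul, ← Finsupp.smul_single, map_smul]
  exact V.smul_mem _ (h x (hu hx))

/-- `c*_γ` is supported by `Γ` when `γ ∈ Γ`, given that the projections preserve the functionals
supported by the elements of `Γ` of lower rank. -/
theorem cFun_mem_of_proj_mem {n : ℕ}
    (hproj : ∀ q, ∀ u ∈ gammaFun m σ n, proj k m n q u ∈ gammaFun m σ n)
    {c : Code (Pre k n)} (hc : Pre.InGamma (m := m) (n := n + 1) σ (Step.new c)) :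
    cFun m c ∈ gammaFun m σ n := by
  obtain ⟨h1, h2⟩ := hc
  cases c with
  | one p j b =>
    have hb := toReal_mem σ fun x hx => ⟨(h1.2.2.2.1 x hx).1, h2.1 x hx⟩
    exact Submodule.smul_mem _ _ (Submodule.sub_mem _ hb (hproj _ _ hb))
  | two ξ j b =>
    have hb := toReal_mem σ fun x hx => ⟨(h1.2.2.2.2.2.2.1 x hx).1, h2.2.1 x hx⟩
    exact Submodule.add_mem _ (Finsupp.single_mem_supported ℝ _ ⟨h1.1, h2.1⟩)
      (Submodule.smul_mem _ _ (Submodule.sub_mem _ hb (hproj _ _ hb)))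

theorem proj_mem : ∀ (n q : ℕ), ∀ u ∈ gammaFun m σ n, proj k m n q u ∈ gammaFun m σ n
  | 0, q, u, hu => by
      by_cases hq : 1 ≤ q
      · simpa [proj, hq] using hu
      · simp [proj, hq]
  | n + 1, q, u, hu => by
      refine linearMap_mem_of_supported (fun x hx => ?_) hu
      rcases x with x | c
      · rw [proj_single_old]
        exact mapDomain_old_mem σ (proj_mem n q _ (Finsupp.single_mem_supported ℝ _ hx))
      · rw [proj_single_new]
        split_ifs
        · exact Finsupp.single_mem_supported ℝ _ hx
        · exact mapDomain_old_mem σ (proj_mem n q _ (cFun_mem_of_proj_mem σ (proj_mem n) hx))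

theorem pairing_shiftPre_of_apply (δ : Node k) (F : Finset (Gamma k m ns N σ)) {n : ℕ}
    (h : ∀ x : Pre k n, Pre.InGamma (m := m) σ x →
      (Pre.G m x).elim 0 (dVal k m δ n) = ∑ γ ∈ F, dVal k m γ.1 n x)
    {u : Pre k n →₀ ℝ} (hu : u ∈ gammaFun m σ n) :
    pairing m δ n (shiftPre m n u) = ∑ γ ∈ F, pairing m γ.1 n u := by
  rw [← LinearMap.comp_apply, ← LinearMap.sum_apply]
  refine linearMap_eq_of_supported (fun x hx => ?_) hu
  rw [LinearMap.comp_apply, LinearMap.sum_apply, shiftFun_single]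
  simp only [pairing_single, one_mul, ← h x hx]
  cases Pre.G m x with
  | none => simp
  | some y => simp

open Classical in
/-- The shift of `d_δ` is the sum of the `d_γ` with `G γ = δ`. -/
theorem dVal_G_eq_sum (δ : Node k) (F : Finset (Gamma k m ns N σ))
    (hF : ∀ γ, γ ∈ F ↔ Node.G m γ.1 = some δ) : ∀ (n : ℕ) (x : Pre k n),
      Pre.InGamma (m := m) σ x →
        (Pre.G m x).elim 0 (dVal k m δ n) = ∑ γ ∈ F, dVal k m γ.1 n x := by
  -- Both sides satisfy `f(γ) = [G γ = δ] + ⟨f, c*_γ⟩`; this is the equality of the first terms.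
  have hind : ∀ {n : ℕ} {x : Pre k n}, Pre.InGamma (m := m) σ x →
      (∑ γ ∈ F, if Pre.toNode x = γ.1 then (1 : ℝ) else 0) =
        (Pre.G m x).elim 0 fun y => if Pre.toNode y = δ then 1 else 0 := by
    intro n x hx
    have h1 : ∀ γ : Gamma k m ns N σ, (Pre.toNode x = γ.1) = (Pre.toGamma σ x hx = γ) := fun γ =>
      propext ⟨fun h => Subtype.ext h, fun h => congrArg Subtype.val h⟩
    simp only [h1, Finset.sum_ite_eq]
    have h2 : Pre.toGamma σ x hx ∈ F ↔ (Pre.G m x).map Pre.toNode = some δ := by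
      rw [hF, ← Node.G_toNode]
      rfl
    rw [if_congr h2 rfl rfl]
    cases Pre.G m x <;> simp
  intro n
  induction n with
  | zero =>
    intro x hx
    exact (hind hx).symm
  | succ n ih =>
    rintro (x | c) hx
    · rw [Pre.G_old, Option.elim_map]
      exact ih x hx
    · have hc := pairing_shiftPre_of_apply σ δ F ih
        (cFun_mem_of_proj_mem σ (proj_mem σ n) hx)
      simp only [dVal_new]
      rw [Finset.sum_add_distrib, hind hx, ← hc]
      rcases shiftPre_cFun m c with ⟨hG, h0⟩ | ⟨c', hG, h0⟩
      · rw [hG, h0]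
        simp
      · rw [hG, h0]
        exact dVal_new m δ n c'

/-! ### The operator on `ℓ_∞(Γ)` -/

section Shift

variable {ι : Type} (g : ι → Option ι)

/-- The operator on `ℓ_∞` with `(S x)(i) = x (g i)`, or `0` if `g i` is undefined. -/
def lpShift : lp (fun _ : ι => ℝ) ∞ →L[ℝ] lp (fun _ : ι => ℝ) ∞ :=
  have hb : ∀ (x : lp (fun _ : ι => ℝ) ∞) (i : ι), ‖(g i).elim (0 : ℝ) fun j => x j‖ ≤ ‖x‖ := by
    intro x i
    cases g i with
    | none => simp
    | some j => exact lp.norm_apply_le_norm ENNReal.top_ne_zero x j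
  LinearMap.mkContinuous
    { toFun := fun x => ⟨fun i => (g i).elim 0 fun j => x j,
        memℓp_infty ⟨‖x‖, by rintro _ ⟨i, rfl⟩; exact hb x i⟩⟩
      map_add' := by
        intro x y
        ext i
        change (g i).elim (0 : ℝ) (fun j => x j + y j) =
          (g i).elim (0 : ℝ) (fun j => x j) + (g i).elim (0 : ℝ) fun j => y j
        cases g i <;> simp
      map_smul' := by
        intro a x
        ext i
        change (g i).elim (0 : ℝ) (fun j => a * x j) = a * (g i).elim (0 : ℝ) fun j => x j
        cases g i <;> simp }
    1 (fun x => by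
      rw [one_mul]
      exact lp.norm_le_of_forall_le (norm_nonneg x) (hb x))

theorem lpShift_apply (x : lp (fun _ : ι => ℝ) ∞) (i : ι) :
    lpShift g x i = (g i).elim 0 fun j => x j := rfl

end Shift

theorem Gamma.inGamma (γ : Gamma k m ns N σ) : Pre.InGamma (m := m) σ γ.1.2.toPre := γ.2

/-- The partial map `G` on `Γ`. -/
def Gamma.G (hk : 0 < k) (γ : Gamma k m ns N σ) : Option (Gamma k m ns N σ) :=
  (Pre.G m γ.1.2.toPre).pmap (fun y hy => Pre.toGamma σ y hy) fun _ hy =>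
    ⟨inMax_G m ns N hy γ.2.1, inGammaAux_G hk σ hy γ.2.2⟩

theorem Gamma.G_map_val (hk : 0 < k) (γ : Gamma k m ns N σ) :
    (Gamma.G σ hk γ).map Subtype.val = Node.G m γ.1 := by
  exact (Option.map_pmap _ _ _ _).trans (Option.pmap_eq_map _ _ _ _)

/-- The vector `d_δ` as an element of `ℓ_∞(Γ)`. -/
def dVec (hg : Growth m ns) (δ : Node k) : lp (fun _ : Gamma k m ns N σ => ℝ) ∞ :=
  ⟨fun γ => dVal k m δ γ.1.1 γ.1.2.toPre, memℓp_infty ⟨1, by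
    rintro _ ⟨γ, rfl⟩
    exact abs_dVal_le_one hg δ _ _ γ.2.1⟩⟩

theorem norm_dVec_le (hg : Growth m ns) (δ : Node k) : ‖dVec (N := N) σ hg δ‖ ≤ 1 :=
  lp.norm_le_of_forall_le zero_le_one fun γ => abs_dVal_le_one hg δ _ _ γ.2.1

theorem dVec_mem_span (hg : Growth m ns) (δ : Gamma k m ns N σ) :
    dVec σ hg δ.1 ∈ Submodule.span ℝ {x : lp (fun _ : Gamma k m ns N σ => ℝ) ∞ |
      ∃ δ : Gamma k m ns N σ, ∀ γ : Gamma k m ns N σ,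
        x γ = dVal k m δ.1 γ.1.1 γ.1.2.toPre} :=
  Submodule.subset_span ⟨δ, fun _ => rfl⟩

theorem lpShift_dVec (hk : 0 < k) (hg : Growth m ns) (δ : Node k) :
    lpShift (Gamma.G σ hk) (dVec σ hg δ) =
      ∑ γ ∈ (finite_gamma_G m ns N σ δ).toFinset, dVec σ hg γ.1 := by
  ext γ
  rw [lpShift_apply, lp.coeFn_sum, Finset.sum_apply]
  have h := dVal_G_eq_sum σ δ (finite_gamma_G m ns N σ δ).toFinset
    (fun γ => Set.Finite.mem_toFinset _) γ.1.1 γ.1.2.toPre (Gamma.inGamma σ γ)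
  refine Eq.trans ?_ h
  have hval := Gamma.G_map_val σ hk γ
  calc (Gamma.G σ hk γ).elim 0 (fun γ' => dVec σ hg δ γ')
      = ((Gamma.G σ hk γ).map Subtype.val).elim 0 fun ν => dVal k m δ ν.1 ν.2.toPre := by
        cases Gamma.G σ hk γ <;> rfl
    _ = (Pre.G m γ.1.2.toPre).elim 0 (dVal k m δ γ.1.1) := by
        rw [hval, Node.G, Option.elim_map]
        congr 1
        funext y
        exact dVal_toNode m δ y

theorem lpShift_mem_space (hk : 0 < k) (hg : Growth m ns) (x : lp (fun _ : Gamma k m ns N σ => ℝ) ∞)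
    (hx : x ∈ space k m ns N σ) : lpShift (Gamma.G σ hk) x ∈ space k m ns N σ := by
  refine map_mem_closure (lpShift (Gamma.G σ hk)).continuous hx fun y hy => ?_
  refine Submodule.span_le (p := (Submodule.span ℝ _).comap
    (lpShift (Gamma.G σ hk)).toLinearMap).2 ?_ hy
  rintro z ⟨δ, hz⟩
  have hzd : z = dVec σ hg δ.1 := by
    ext γ
    exact hz γ
  rw [hzd]
  refine Submodule.mem_comap.2 (Set.mem_of_eq_of_mem (lpShift_dVec σ hk hg δ.1) ?_)
  exact Submodule.sum_mem _ fun γ _ => dVec_mem_span σ hg γ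

/-- The operator `S` on `𝔛_k`. -/
def shiftX (hk : 0 < k) (hg : Growth m ns) : X k m ns N σ →L[ℝ] X k m ns N σ :=
  show space k m ns N σ →L[ℝ] space k m ns N σ from
    ((lpShift (Gamma.G σ hk)).comp (space k m ns N σ).subtypeL).codRestrict _
      fun x => lpShift_mem_space σ hk hg x.1 x.2

theorem coord_shiftX (hk : 0 < k) (hg : Growth m ns) (x : X k m ns N σ) (γ : Gamma k m ns N σ) :
    (shiftX σ hk hg x).coord γ = (Gamma.G σ hk γ).elim 0 fun δ => x.coord δ := rfl

theorem isShift_shiftX (hk : 0 < k) (hg : Growth m ns) : IsShift (shiftX (N := N) σ hk hg) := by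
  intro x γ
  rw [coord_shiftX, ← Gamma.G_map_val σ hk]
  cases Gamma.G σ hk γ with
  | none => exact Or.inl ⟨rfl, rfl⟩
  | some δ => exact Or.inr ⟨δ, rfl, rfl⟩

variable {σ}

theorem X.ext_coord {x y : X k m ns N σ} (h : ∀ γ, x.coord γ = y.coord γ) : x = y :=
  Subtype.ext (lp.ext (funext h))

theorem IsShift.coord_of_none {S : X k m ns N σ →L[ℝ] X k m ns N σ} (hS : IsShift S)
    {γ : Gamma k m ns N σ} (h : Node.G m γ.1 = none) (x : X k m ns N σ) :
    (S x).coord γ = 0 := by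
  rcases hS x γ with ⟨-, h'⟩ | ⟨δ, h', -⟩
  · exact h'
  · rw [h] at h'
    cases h'

theorem IsShift.coord_of_some {S : X k m ns N σ →L[ℝ] X k m ns N σ} (hS : IsShift S)
    {γ δ : Gamma k m ns N σ} (h : Node.G m γ.1 = some δ.1) (x : X k m ns N σ) :
    (S x).coord γ = x.coord δ := by
  rcases hS x γ with ⟨h', -⟩ | ⟨δ', h', hx⟩
  · rw [h] at h'
    cases h'
  · rw [h] at h'
    rw [hx, Subtype.ext (Option.some.inj h')]

theorem IsShift.unique {S T : X k m ns N σ →L[ℝ] X k m ns N σ} (hS : IsShift S) (hT : IsShift T) :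
    S = T := by
  ext x
  refine X.ext_coord fun γ => ?_
  rcases hS x γ with ⟨h, h0⟩ | ⟨δ, h, h0⟩
  · rw [h0, hT.coord_of_none h]
  · rw [h0, hT.coord_of_some h]

/-! ### Chains of length `k` in every rank -/

/-- An element of rank `1` as one of rank at most `n + 1`. -/
def embed : ∀ n : ℕ, Fin k → Pre k n
  | 0, i => i
  | n + 1, i => Step.old (embed n i)

/-- The element `(n + 2, 0, (m 2)⁻¹, e*_i)` of rank `n + 2`, where `i` is an element of rank `1`.
The weight index `2` is even, so that the restriction imposed on odd weights in the definition of
`Γ` does not apply. -/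
def chain (n : ℕ) (i : Fin k) : Pre k (n + 1) :=
  Step.new (Code.one 0 2 (Finsupp.single (embed n i) 1))

theorem embed_injective : ∀ n : ℕ, Function.Injective (embed (k := k) n)
  | 0, _, _, h => h
  | n + 1, _, _, h => embed_injective n (Step.old.inj h)

theorem inGamma_embed (σ : GammaMax k ns N → ℕ) : ∀ (n : ℕ) (i : Fin k),
    Pre.InGamma (m := m) σ (embed n i)
  | 0, _ => ⟨trivial, trivial⟩
  | n + 1, i => inGamma_embed σ n i

theorem inGamma_chain (σ : GammaMax k ns N → ℕ) (n : ℕ) (i : Fin k) :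
    Pre.InGamma (m := m) σ (chain n i) := by
  have hs : ∀ η ∈ (Finsupp.single (embed n i) (1 : ℚ)).support, η = embed n i := fun η hη =>
    Finset.mem_singleton.1 (Finsupp.support_single_subset hη)
  have h := inGamma_embed (m := m) σ n i
  refine ⟨⟨n.succ_pos, one_le_two, Nat.le_add_left 2 n, fun η hη => ?_, ?_, fun η => ?_⟩,
    fun η hη => ?_, fun h2 => absurd h2 (by decide)⟩
  · rw [hs η hη]
    exact ⟨h.1, Pre.one_le_rank _⟩
  · rw [toReal_single, l1norm_single]
    simp
  · classical
    rw [Finsupp.single_apply]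
    split_ifs <;> simp
  · rw [hs η hη]
    exact h.2

theorem G_embed_zero (n : ℕ) (h : 0 < k) : Pre.G m (embed n (⟨0, h⟩ : Fin k)) = none := by
  induction n with
  | zero => simp [embed, Pre.G]
  | succ n ih => exact (Pre.G_old m _).trans (by rw [ih]; rfl)

theorem G_embed_succ (n i : ℕ) (h : i + 1 < k) :
    Pre.G m (embed n (⟨i + 1, h⟩ : Fin k)) = some (embed n ⟨i, Nat.lt_of_succ_lt h⟩) := by
  induction n with
  | zero => simp [embed, Pre.G]
  | succ n ih => exact (Pre.G_old m _).trans (by rw [ih]; rfl)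

theorem proj_zero (m : ℕ → ℕ) (n : ℕ) : proj k m n 0 = 0 := by
  induction n with
  | zero => simp [proj]
  | succ n ih =>
    refine Finsupp.lhom_ext' fun x => LinearMap.ext_ring ?_
    rcases x with x | c
    · exact (proj_single_old m n 0 x).trans (by simp [ih])
    · exact (proj_single_new m n 0 c).trans (by simp [ih])

theorem G_chain_zero (n : ℕ) (h : 0 < k) : Pre.G m (chain n (⟨0, h⟩ : Fin k)) = none := by
  rw [chain, Pre.G_one, rStar_single, G_embed_zero]
  simp [tail]

theorem G_chain_succ (n i : ℕ) (h : i + 1 < k) :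
    Pre.G m (chain n (⟨i + 1, h⟩ : Fin k)) = some (chain n ⟨i, Nat.lt_of_succ_lt h⟩) := by
  rw [chain, Pre.G_one, rStar_single, G_embed_succ, Option.elim_some, if_neg]
  · rfl
  · rw [tail, proj_zero, toReal_single]
    simp

/-- The elements `chain n i` as elements of `Γ`. -/
def chainGamma (m : ℕ → ℕ) (σ : GammaMax k ns N → ℕ) (n : ℕ) (i : Fin k) : Gamma k m ns N σ :=
  Pre.toGamma σ (chain n i) (inGamma_chain σ n i)

/-- The vector `d_δ`, `δ ∈ Γ`, as an element of `𝔛_k`. -/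
def dX (hg : Growth m ns) (δ : Gamma k m ns N σ) : X k m ns N σ :=
  show space k m ns N σ from ⟨dVec σ hg δ.1, subset_closure (dVec_mem_span σ hg δ)⟩

theorem norm_dX_le (hg : Growth m ns) (δ : Gamma k m ns N σ) : ‖dX hg δ‖ ≤ 1 :=
  norm_dVec_le σ hg δ.1

theorem dX_coord_chain_of_lt (hg : Growth m ns) {n n' : ℕ} (h : n' < n) (i i' : Fin k) :
    (dX hg (chainGamma m σ n i)).coord (chainGamma m σ n' i') = 0 :=
  dVal_of_rank_lt m _ (n' + 1) (chain n' i') (by change n' + 2 < n + 2; omega)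

theorem dX_coord_chain (hg : Growth m ns) (n : ℕ) (i i' : Fin k) :
    (dX hg (chainGamma m σ n i)).coord (chainGamma m σ n i') = if i' = i then 1 else 0 := by
  classical
  refine (dVal_of_rank_le m (Pre.toNode (chain n i)) (n + 1) (chain n i') le_rfl).trans ?_
  refine if_congr ⟨fun h => ?_, fun h => by rw [h]⟩ rfl rfl
  have h1 := eq_of_heq (Sigma.mk.inj h).2
  exact embed_injective n (Finsupp.single_left_injective one_ne_zero (Code.one.inj h1).2.2)

/-- Evaluation at a coordinate, as a linear functional. -/
def coordHom (γ : Gamma k m ns N σ) : X k m ns N σ →ₗ[ℝ] ℝ where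
  toFun x := x.coord γ
  map_add' _ _ := rfl
  map_smul' _ _ := rfl

theorem abs_coordHom_le (γ : Gamma k m ns N σ) (x : X k m ns N σ) : |coordHom γ x| ≤ ‖x‖ :=
  lp.norm_apply_le_norm ENNReal.top_ne_zero (show space k m ns N σ from x).1 γ

theorem IsShift.pow_coord_chain {S : X k m ns N σ →L[ℝ] X k m ns N σ} (hS : IsShift S)
    (n a : ℕ) (i : Fin k) (x : X k m ns N σ) :
    ((S ^ a) x).coord (chainGamma m σ n i) =
      if a ≤ i.val then x.coord (chainGamma m σ n ⟨i.val - a, by omega⟩) else 0 := by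
  induction a generalizing i with
  | zero => simp
  | succ a ih =>
    rw [pow_succ']
    change (S ((S ^ a) x)).coord _ = _
    obtain ⟨i, hi⟩ := i
    have hG := Node.G_toNode m (chain n (⟨i, hi⟩ : Fin k))
    cases i with
    | zero =>
      rw [G_chain_zero] at hG
      rw [hS.coord_of_none hG]
      simp
    | succ i =>
      rw [G_chain_succ] at hG
      rw [hS.coord_of_some (δ := chainGamma m σ n ⟨i, Nat.lt_of_succ_lt hi⟩) hG, ih]
      simp

/-- The operator `∑ c_a S^a`, applied to `d_δ` with `δ = chain n 0`, has the coordinates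
`c_i` at `chain n i`, and `0` at the chains of lower rank. -/
theorem IsShift.sum_coord_chain {S : X k m ns N σ →L[ℝ] X k m ns N σ} (hS : IsShift S)
    (hg : Growth m ns) (c : Fin k → ℝ) (hk : 0 < k) {n n' : ℕ} (hn : n' ≤ n) (i : Fin k) :
    coordHom (chainGamma m σ n' i) ((∑ a : Fin k, c a • S ^ (a : ℕ) :
      X k m ns N σ →L[ℝ] X k m ns N σ) (dX hg (chainGamma m σ n ⟨0, hk⟩))) =
      if n' = n then c i else 0 := by
  rw [sum_apply, map_sum]
  have hterm : ∀ a : Fin k, coordHom (chainGamma m σ n' i)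
      ((c a • S ^ (a : ℕ)) (dX hg (chainGamma m σ n ⟨0, hk⟩))) =
        if a = i then (if n' = n then c i else 0) else 0 := by
    intro a
    rw [smul_apply, map_smul, smul_eq_mul]
    change c a * ((S ^ (a : ℕ)) _).coord _ = _
    rw [hS.pow_coord_chain]
    rcases hn.lt_or_eq with hlt | rfl
    · rw [dX_coord_chain_of_lt hg hlt]
      simp [hlt.ne]
    · rw [dX_coord_chain]
      by_cases hai : a = i
      · subst hai
        simp
      · have : ¬ (a.val ≤ i.val ∧ i.val - a.val = 0) := fun h => hai (Fin.ext (by omega))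
        by_cases h1 : a.val ≤ i.val
        · have h2 : i.val - a.val ≠ 0 := fun h => this ⟨h1, h⟩
          simp [hai, h1, Fin.ext_iff, h2]
        · simp [hai, h1]
  simp only [hterm, Finset.sum_ite_eq', Finset.mem_univ, if_true]

/-- A compact operator maps no bounded sequence to a sequence whose terms keep a positive distance
from each other. -/
theorem not_isCompactOperator_of_separated {E F : Type} [NormedAddCommGroup E] [NormedSpace ℝ E]
    [NormedAddCommGroup F] [NormedSpace ℝ F] (T : E →L[ℝ] F) {x : ℕ → E} {r ε : ℝ}
    (hx : ∀ n, ‖x n‖ ≤ r) (hε : 0 < ε) (hsep : ∀ n' n, n' < n → ε ≤ ‖T (x n) - T (x n')‖) :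
    ¬ IsCompactOperator T := by
  intro hT
  have hK := IsCompactOperator.isCompact_closure_image_closedBall (f := T.toLinearMap) hT r
  obtain ⟨y, -, φ, hφ, hy⟩ := hK.tendsto_subseq (x := fun n => T (x n)) fun n =>
    subset_closure ⟨x n, mem_closedBall_zero_iff.2 (hx n), rfl⟩
  obtain ⟨M, hM⟩ := Metric.cauchySeq_iff.1 hy.cauchySeq ε hε
  have h1 := hM (M + 1) (Nat.le_succ M) M le_rfl
  rw [dist_eq_norm] at h1
  exact absurd h1 (not_lt.2 (hsep _ _ (hφ (Nat.lt_succ_self M))))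

theorem IsShift.eq_zero_of_isCompactOperator {S : X k m ns N σ →L[ℝ] X k m ns N σ}
    (hS : IsShift S) (hg : Growth m ns) (c : Fin k → ℝ)
    (hc : IsCompactOperator (∑ a : Fin k, c a • S ^ (a : ℕ) :
      X k m ns N σ →L[ℝ] X k m ns N σ)) (i : Fin k) : c i = 0 := by
  by_contra hi
  have hk : 0 < k := i.pos
  refine not_isCompactOperator_of_separated _
    (x := fun n => dX hg (chainGamma m σ n ⟨0, hk⟩)) (fun n => norm_dX_le hg _)
    (abs_pos.2 hi) (fun n' n hn => ?_) hc
  refine le_trans (le_of_eq ?_) (abs_coordHom_le (chainGamma m σ n' i) _)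
  rw [map_sub, hS.sum_coord_chain hg c hk hn.le, hS.sum_coord_chain hg c hk le_rfl]
  simp [hn.ne]

end BDSpace

end

theorem corollary3p8 (k : ℕ) (hk : 2 ≤ k) (m ns N : ℕ → ℕ) (hgrowth : BDSpace.Growth m ns)
    (hnet : BDSpace.NetSeq k ns N) (σ : BDSpace.GammaMax k ns N → ℕ) (hσ : BDSpace.Coding σ) :
    (∃! S : BDSpace.X k m ns N σ →L[ℝ] BDSpace.X k m ns N σ, BDSpace.IsShift S) ∧
    ∀ S : BDSpace.X k m ns N σ →L[ℝ] BDSpace.X k m ns N σ, BDSpace.IsShift S →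
      (∀ c : Fin k → ℝ,
        IsCompactOperator
          (∑ i : Fin k, c i • S ^ (i : ℕ) : BDSpace.X k m ns N σ →L[ℝ] BDSpace.X k m ns N σ) →
        ∀ i, c i = 0) ∧
      (∀ j : Fin k, ¬ ∃ (c : Fin k → ℝ) (K : BDSpace.X k m ns N σ →L[ℝ] BDSpace.X k m ns N σ),
        IsCompactOperator K ∧
          S ^ (j : ℕ) = ∑ l ∈ Finset.univ.erase j, c l • S ^ (l : ℕ) + K) ∧
      LinearIndependent ℝ (fun i : Fin k => BDSpace.toCalkin (S ^ (i : ℕ))) := by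
  have hk0 : 0 < k := by omega
  refine ⟨⟨BDSpace.shiftX σ hk0 hgrowth, BDSpace.isShift_shiftX σ hk0 hgrowth,
    fun T hT => hT.unique (BDSpace.isShift_shiftX σ hk0 hgrowth)⟩, fun S hS => ?_⟩
  have main := hS.eq_zero_of_isCompactOperator hgrowth
  refine ⟨main, ?_, ?_⟩
  · rintro j ⟨c, K, hK, h⟩
    have hsum : (∑ i : Fin k, (if i = j then 1 else -c i) • S ^ (i : ℕ)) = K := by
      rw [← Finset.add_sum_erase _ _ (Finset.mem_univ j), if_pos rfl, one_smul]
      have : ∑ i ∈ Finset.univ.erase j, (if i = j then 1 else -c i) • S ^ (i : ℕ) =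
          -∑ i ∈ Finset.univ.erase j, c i • S ^ (i : ℕ) := by
        rw [← Finset.sum_neg_distrib]
        refine Finset.sum_congr rfl fun i hi => ?_
        rw [if_neg (Finset.ne_of_mem_erase hi), neg_smul]
      rw [this, h]
      abel
    have := main (fun i => if i = j then 1 else -c i) (by rw [hsum]; exact hK) j
    simp at this
  · refine Fintype.linearIndependent_iff.2 fun c hc => main c ?_
    have h : (Submodule.Quotient.mk (∑ i : Fin k, c i • S ^ (i : ℕ)) :
        BDSpace.Calkin (BDSpace.X k m ns N σ)) = 0 := by
      rw [← hc, ← Submodule.mkQ_apply, map_sum]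
      rfl
    exact (Submodule.Quotient.mk_eq_zero _).1 h
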